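/- Let $n\in\mathbb N$, $T>0$, and consider the third order operator $\partial_t^3+\sum_{j=0}^{2}\sum_{|\alpha|\le 3-j}a_{j,\alpha}(t)\,\partial_t^j\partial_x^\alpha$ on $[0,T]\times\mathbb R^n$, whose coefficients are analytic in a neighbourhood of $[0,T]$, real valued for $j+|\alpha|=3$ and possibly complex valued for $j+|\alpha|\le 2$. Set $$L=\tau^3+\sum_{j+|\alpha|=3}a_{j,\alpha}\tau^j\xi^\alpha,\quad M=\sum_{j+|\alpha|=2}a_{j,\alpha}\tau^j\xi^\alpha,\quad N=\sum_{j+|\alpha|=1}a_{j,\alpha}\tau^j\xi^\alpha,$$ where $j\le 2$ in all sums, and $$\check N=N-\tfrac12\,\partial_t\partial_\tau M+\tfrac1{12}\,\partial_t^2\partial_\tau^2L,\qquad \mathcal L=L-\partial_\tau^2L .$$ Assume that for all $t\in[0,T]$, $\xi\in\mathbb R^n$ the polynomial $L(t,\cdot,\xi)$ has only real roots. Let $\sigma_1\le\sigma_2$ be the roots of $\partial_\tau L(t,\cdot,\xi)$, let $\mu_1<\mu_2$ be the roots of $\partial_\tau\mathcal L(t,\cdot,\xi)$ (all of them are then real),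 put $\Delta(t,\xi)=(\sigma_1(t,\xi)-\sigma_2(t,\xi))^2$, and assume that $\Delta\not\equiv0$ on $[0,T]\times\mathbb R^n$. Consider the following conditions. (A) There is $C>0$ such that, for $j=1,2$ and all $(t,\xi)\in[0,T]\times\mathbb R^n$ with $\Delta(t,\xi)\ne0$, $$|\check N(t,\sigma_j(t,\xi),\xi)|\le C\Bigl(\sqrt{\Delta(t,\xi)}+\frac{(\partial_t\Delta(t,\xi))^2}{\Delta(t,\xi)^{3/2}}\Bigr).$$ (B) (Levi condition) There is $C>0$ such that, for all $\xi\in\mathbb R^n$ with $|\xi|\ge1$, $$\int_0^T\sum_{j=1}^2\sqrt{\frac{|\check N(t,\mu_j(t,\xi),\xi)|}{|\mu_2(t,\xi)-\mu_1(t,\xi)|}}\;dt\le C\log(1+|\xi|).$$ (C) There are finitely many pairwise distinct real numbers $t_1,\dots,t_\nu$ and $C>0$ such that, for all $(t,\xi)\in[0,T]\times\mathbb R^n$, $$\prod_{j=1}^\nu(t-t_j)^2\;|\check N(t,\sigma_1(t,\xi),\xi)|\le C\,|\sigma_2(t,\xi)-\sigma_1(t,\xi)| .$$ Then (A) implies (B).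 If $n=1$, then (A), (B) and (C) are equivalent. -/

import Mathlib

/-- The coefficients `a_{j,α}(t)`, `0 ≤ j ≤ 2`, `j + |α| ≤ 3`, of the operator
`∂ₜ³ + ∑_{j ≤ 2} ∑_{|α| ≤ 3 - j} a_{j,α}(t) ∂ₜʲ ∂ₓ^α` in space dimension `n`. Those with
`j + |α| = 3` are real valued (field `lead`), the others may be complex valued (field `lower`).
Values of the two families at other indices `(j, α)` are never used. -/
structure ThirdOrderOperator (n : ℕ) where
  lead : ℕ → (Fin n → ℕ) → ℝ → ℝ
  lower : ℕ → (Fin n → ℕ) → ℝ → ℂ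

namespace ThirdOrderOperator

variable {n : ℕ} (P : ThirdOrderOperator n)

/-- The monomial `ξ^α`. -/
def monom (ξ : EuclideanSpace ℝ (Fin n)) (α : Fin n → ℕ) : ℝ := ∏ i, ξ i ^ α i

/-- `L(t,τ,ξ) = τ³ + ∑_{j + |α| = 3} a_{j,α}(t) τ^j ξ^α`. The finset
`Finset.piAntidiag Finset.univ k` consists of the multi-indices `α` with `|α| = k`. -/
def symL (t τ : ℝ) (ξ : EuclideanSpace ℝ (Fin n)) : ℝ :=
  τ ^ 3 + ∑ j ∈ Finset.range 3, ∑ α ∈ Finset.piAntidiag Finset.univ (3 - j),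
    P.lead j α t * τ ^ j * monom ξ α

/-- `M(t,τ,ξ) = ∑_{j + |α| = 2} a_{j,α}(t) τ^j ξ^α`. -/
def symM (t τ : ℝ) (ξ : EuclideanSpace ℝ (Fin n)) : ℂ :=
  ∑ j ∈ Finset.range 3, ∑ α ∈ Finset.piAntidiag Finset.univ (2 - j),
    P.lower j α t * (τ : ℂ) ^ j * (monom ξ α : ℂ)

/-- `N(t,τ,ξ) = ∑_{j + |α| = 1} a_{j,α}(t) τ^j ξ^α`. -/
def symN (t τ : ℝ) (ξ : EuclideanSpace ℝ (Fin n)) : ℂ :=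
  ∑ j ∈ Finset.range 2, ∑ α ∈ Finset.piAntidiag Finset.univ (1 - j),
    P.lower j α t * (τ : ℂ) ^ j * (monom ξ α : ℂ)

/-- `Ň = N - (1/2) ∂ₜ ∂_τ M + (1/12) ∂ₜ² ∂_τ² L`. -/
noncomputable def symNcheck (t τ : ℝ) (ξ : EuclideanSpace ℝ (Fin n)) : ℂ :=
  P.symN t τ ξ
    - (1 / 2 : ℂ) * deriv (fun s : ℝ => deriv (fun z : ℝ => P.symM s z ξ) τ) t
    + (1 / 12 : ℂ) *
      ((iteratedDeriv 2 (fun s : ℝ => iteratedDeriv 2 (fun z : ℝ => P.symL s z ξ) τ) t : ℝ) : ℂ)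

/-- The auxiliary polynomial `𝓛 = L - ∂_τ² L`. -/
noncomputable def symLaux (t τ : ℝ) (ξ : EuclideanSpace ℝ (Fin n)) : ℝ :=
  P.symL t τ ξ - iteratedDeriv 2 (fun z : ℝ => P.symL t z ξ) τ

/-- `∂_τ L`. -/
noncomputable def dL (t τ : ℝ) (ξ : EuclideanSpace ℝ (Fin n)) : ℝ :=
  deriv (fun z : ℝ => P.symL t z ξ) τ

/-- `∂_τ 𝓛`. -/
noncomputable def dLaux (t τ : ℝ) (ξ : EuclideanSpace ℝ (Fin n)) : ℝ :=
  deriv (fun z : ℝ => P.symLaux t z ξ) τ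

/-- The smaller root `σ₁(t,ξ)` of the quadratic polynomial `∂_τ L(t,·,ξ)`. -/
noncomputable def σ₁ (t : ℝ) (ξ : EuclideanSpace ℝ (Fin n)) : ℝ := sInf {τ | P.dL t τ ξ = 0}

/-- The larger root `σ₂(t,ξ)` of the quadratic polynomial `∂_τ L(t,·,ξ)`. -/
noncomputable def σ₂ (t : ℝ) (ξ : EuclideanSpace ℝ (Fin n)) : ℝ := sSup {τ | P.dL t τ ξ = 0}

/-- The smaller root `μ₁(t,ξ)` of the quadratic polynomial `∂_τ 𝓛(t,·,ξ)`. -/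
noncomputable def μ₁ (t : ℝ) (ξ : EuclideanSpace ℝ (Fin n)) : ℝ := sInf {τ | P.dLaux t τ ξ = 0}

/-- The larger root `μ₂(t,ξ)` of the quadratic polynomial `∂_τ 𝓛(t,·,ξ)`. -/
noncomputable def μ₂ (t : ℝ) (ξ : EuclideanSpace ℝ (Fin n)) : ℝ := sSup {τ | P.dLaux t τ ξ = 0}

/-- The discriminant `Δ_{∂_τ L}(t,ξ) = (σ₁(t,ξ) - σ₂(t,ξ))²` of `∂_τ L`. -/
noncomputable def Δ (t : ℝ) (ξ : EuclideanSpace ℝ (Fin n)) : ℝ := (P.σ₁ t ξ - P.σ₂ t ξ) ^ 2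

/-- All coefficients are (real-)analytic in `t` on a neighbourhood of `[0,T]`. -/
def AnalyticCoefficients (T : ℝ) : Prop :=
  (∀ (j : ℕ) (α : Fin n → ℕ), j < 3 → j + ∑ i, α i = 3 →
      AnalyticOnNhd ℝ (P.lead j α) (Set.Icc 0 T)) ∧
  (∀ (j : ℕ) (α : Fin n → ℕ), j + ∑ i, α i ≤ 2 →
      AnalyticOnNhd ℝ (P.lower j α) (Set.Icc 0 T))

/-- Weak hyperbolicity on `[0,T]`: the cubic `L(t,·,ξ)` has three real roots
(counted with multiplicity). -/
def WeaklyHyperbolic (T : ℝ) : Prop :=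
  ∀ t ∈ Set.Icc 0 T, ∀ ξ : EuclideanSpace ℝ (Fin n), ∃ τ₁ τ₂ τ₃ : ℝ, τ₁ ≤ τ₂ ∧ τ₂ ≤ τ₃ ∧
    ∀ τ : ℝ, P.symL t τ ξ = (τ - τ₁) * (τ - τ₂) * (τ - τ₃)

/-- The integral Levi condition on the terms of order one:
`∫₀ᵀ ∑_{j=1,2} √(|Ň(t,μ_j,ξ)| / |μ₂ - μ₁|) dt ≲ log (1 + |ξ|)`, for `|ξ| ≥ 1`. -/
def IntegralLevi (T : ℝ) : Prop :=
  ∃ C : ℝ, 0 < C ∧ ∀ ξ : EuclideanSpace ℝ (Fin n), 1 ≤ ‖ξ‖ →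
    IntervalIntegrable (fun t : ℝ =>
        √(‖P.symNcheck t (P.μ₁ t ξ) ξ‖ / |P.μ₂ t ξ - P.μ₁ t ξ|)
          + √(‖P.symNcheck t (P.μ₂ t ξ) ξ‖ / |P.μ₂ t ξ - P.μ₁ t ξ|))
      MeasureTheory.volume 0 T ∧
    ∫ t in (0 : ℝ)..T,
        (√(‖P.symNcheck t (P.μ₁ t ξ) ξ‖ / |P.μ₂ t ξ - P.μ₁ t ξ|)
          + √(‖P.symNcheck t (P.μ₂ t ξ) ξ‖ / |P.μ₂ t ξ - P.μ₁ t ξ|))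
      ≤ C * Real.log (1 + ‖ξ‖)

/-- The pointwise condition `|Ň(t,σ_j,ξ)| ≲ √Δ + (∂ₜΔ)² / Δ^{3/2}`, `j = 1, 2`, at the points
where `Δ ≠ 0` (elsewhere the right-hand side is not defined). -/
def PointwiseLevi (T : ℝ) : Prop :=
  ∃ C : ℝ, 0 < C ∧ ∀ t ∈ Set.Icc 0 T, ∀ ξ : EuclideanSpace ℝ (Fin n), P.Δ t ξ ≠ 0 →
    ‖P.symNcheck t (P.σ₁ t ξ) ξ‖ ≤
        C * (√(P.Δ t ξ)
          + (derivWithin (fun s => P.Δ s ξ) (Set.Icc 0 T) t) ^ 2 / P.Δ t ξ ^ (3 / 2 : ℝ)) ∧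
    ‖P.symNcheck t (P.σ₂ t ξ) ξ‖ ≤
        C * (√(P.Δ t ξ)
          + (derivWithin (fun s => P.Δ s ξ) (Set.Icc 0 T) t) ^ 2 / P.Δ t ξ ^ (3 / 2 : ℝ))

/-- There are finitely many pairwise distinct points `t₁, …, t_ν` (the elements of `S`) with
`∏ⱼ (t - tⱼ)² |Ň(t,σ₁,ξ)| ≲ |σ₂ - σ₁|`. -/
def ProductLevi (T : ℝ) : Prop :=
  ∃ S : Finset ℝ, ∃ C : ℝ, 0 < C ∧
    ∀ t ∈ Set.Icc 0 T, ∀ ξ : EuclideanSpace ℝ (Fin n),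
      (∏ s ∈ S, (t - s) ^ 2) * ‖P.symNcheck t (P.σ₁ t ξ) ξ‖ ≤ C * |P.σ₂ t ξ - P.σ₁ t ξ|

/-! Under weak hyperbolicity `σ₁ ≤ σ₂` and `μ₁ < μ₂` really are the roots, with multiplicity, of
`∂_τ L` and `∂_τ 𝓛`. -/

theorem quadratic_roots {f : ℝ → ℝ} {b c : ℝ} (hf : ∀ x, f x = 3 * x ^ 2 + 2 * b * x + c)
    (h : 0 ≤ b ^ 2 - 3 * c) (x : ℝ) :
    f x = 3 * (x - sInf {y | f y = 0}) * (x - sSup {y | f y = 0}) ∧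
      sSup {y | f y = 0} - sInf {y | f y = 0} = 2 / 3 * √(b ^ 2 - 3 * c) := by
  set d := √(b ^ 2 - 3 * c) with hd
  have hd2 : d ^ 2 = b ^ 2 - 3 * c := Real.sq_sqrt h
  have hd0 : 0 ≤ d := Real.sqrt_nonneg _
  have hfac : ∀ y, f y = 3 * (y - (-b - d) / 3) * (y - (-b + d) / 3) := by
    intro y
    rw [hf y]
    linear_combination (1 / 3) * hd2
  have hset : {y | f y = 0} = {(-b - d) / 3, (-b + d) / 3} := by
    ext y
    simp only [Set.mem_ofPred_eq, Set.mem_insert_iff, Set.mem_singleton_iff, hfac y]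
    simp [sub_eq_zero]
  have hle : (-b - d) / 3 ≤ (-b + d) / 3 := by linarith
  rw [hset, csInf_pair, csSup_pair, inf_eq_left.2 hle, sup_eq_right.2 hle]
  exact ⟨hfac x, by ring⟩

theorem dL_of_factor {P : ThirdOrderOperator n} {t τ₁ τ₂ τ₃ : ℝ} {ξ : EuclideanSpace ℝ (Fin n)}
    (h : ∀ τ : ℝ, P.symL t τ ξ = (τ - τ₁) * (τ - τ₂) * (τ - τ₃)) (τ : ℝ) :
    P.dL t τ ξ = 3 * τ ^ 2 + 2 * (-(τ₁ + τ₂ + τ₃)) * τ + (τ₁ * τ₂ + τ₂ * τ₃ + τ₃ * τ₁) ∧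
    P.dLaux t τ ξ =
      3 * τ ^ 2 + 2 * (-(τ₁ + τ₂ + τ₃)) * τ + (τ₁ * τ₂ + τ₂ * τ₃ + τ₃ * τ₁ - 6) := by
  have e : (fun z : ℝ => P.symL t z ξ) = fun z => (z - τ₁) * (z - τ₂) * (z - τ₃) := funext h
  have d1 : ∀ z : ℝ, HasDerivAt (fun z : ℝ => (z - τ₁) * (z - τ₂) * (z - τ₃))
      (3 * z ^ 2 + 2 * (-(τ₁ + τ₂ + τ₃)) * z + (τ₁ * τ₂ + τ₂ * τ₃ + τ₃ * τ₁)) z := by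
    intro z
    have := (((hasDerivAt_id z).sub_const τ₁).mul ((hasDerivAt_id z).sub_const τ₂)).mul
      ((hasDerivAt_id z).sub_const τ₃)
    refine this.congr_deriv ?_
    simp only [id, Pi.mul_apply]
    ring
  have e1 : deriv (fun z : ℝ => P.symL t z ξ) = fun z =>
      3 * z ^ 2 + 2 * (-(τ₁ + τ₂ + τ₃)) * z + (τ₁ * τ₂ + τ₂ * τ₃ + τ₃ * τ₁) := by
    rw [e]
    exact funext fun z => (d1 z).deriv
  have d2 : ∀ z : ℝ, HasDerivAt (fun z : ℝ =>
      3 * z ^ 2 + 2 * (-(τ₁ + τ₂ + τ₃)) * z + (τ₁ * τ₂ + τ₂ * τ₃ + τ₃ * τ₁))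
      (6 * z + 2 * (-(τ₁ + τ₂ + τ₃))) z := by
    intro z
    have := (((hasDerivAt_pow 2 z).const_mul 3).add
      ((hasDerivAt_id z).const_mul (2 * (-(τ₁ + τ₂ + τ₃))))).add_const
        (τ₁ * τ₂ + τ₂ * τ₃ + τ₃ * τ₁)
    refine this.congr_deriv ?_
    norm_num
    ring
  refine ⟨congrFun e1 τ, ?_⟩
  have e2 : (fun z : ℝ => P.symLaux t z ξ) = fun z =>
      (z - τ₁) * (z - τ₂) * (z - τ₃) - (6 * z + 2 * (-(τ₁ + τ₂ + τ₃))) := by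
    funext z
    have : iteratedDeriv 2 (fun z : ℝ => P.symL t z ξ) z = 6 * z + 2 * (-(τ₁ + τ₂ + τ₃)) := by
      rw [iteratedDeriv_succ, iteratedDeriv_one, e1]
      exact (d2 z).deriv
    rw [symLaux, this, h z]
  rw [dLaux, e2]
  have := (d1 τ).sub (((hasDerivAt_id τ).const_mul 6).add_const (2 * (-(τ₁ + τ₂ + τ₃))))
  refine (this.congr_deriv ?_).deriv
  ring

theorem WeaklyHyperbolic.roots {P : ThirdOrderOperator n} {T : ℝ} (hP : P.WeaklyHyperbolic T)
    {t : ℝ} (ht : t ∈ Set.Icc 0 T) (ξ : EuclideanSpace ℝ (Fin n)) :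
    (∀ τ, P.dL t τ ξ = 3 * (τ - P.σ₁ t ξ) * (τ - P.σ₂ t ξ)) ∧ P.σ₁ t ξ ≤ P.σ₂ t ξ ∧
    (∀ τ, P.dLaux t τ ξ = 3 * (τ - P.μ₁ t ξ) * (τ - P.μ₂ t ξ)) ∧ P.μ₁ t ξ < P.μ₂ t ξ := by
  obtain ⟨τ₁, τ₂, τ₃, -, -, h⟩ := hP t ht ξ
  have hq : 0 ≤ (-(τ₁ + τ₂ + τ₃)) ^ 2 - 3 * (τ₁ * τ₂ + τ₂ * τ₃ + τ₃ * τ₁) := by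
    nlinarith [sq_nonneg (τ₁ - τ₂), sq_nonneg (τ₂ - τ₃), sq_nonneg (τ₃ - τ₁)]
  have hq' : 0 < (-(τ₁ + τ₂ + τ₃)) ^ 2 - 3 * (τ₁ * τ₂ + τ₂ * τ₃ + τ₃ * τ₁ - 6) := by linarith
  have A := quadratic_roots (fun τ => (dL_of_factor h τ).1) hq
  have B := quadratic_roots (fun τ => (dL_of_factor h τ).2) hq'.le
  refine ⟨fun τ => (A τ).1, ?_, fun τ => (B τ).1, ?_⟩
  · have := (A 0).2
    have h0 := Real.sqrt_nonneg
      ((-(τ₁ + τ₂ + τ₃)) ^ 2 - 3 * (τ₁ * τ₂ + τ₂ * τ₃ + τ₃ * τ₁))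
    simp only [σ₁, σ₂]
    linarith
  · have := (B 0).2
    have h0 := Real.sqrt_pos.2 hq'
    simp only [μ₁, μ₂]
    linarith

end ThirdOrderOperator

/-!
Two facts about the symbols reduce everything to an inequality between a quadratic form
and a linear form. The discriminant `Δ(t, ·)` is a nonnegative quadratic form `p` in `ξ`, with
`|σ₂ - σ₁| = √p` and `|μ₂ - μ₁| = √(p + 8)`. The value `g` of `Ň` at the common midpoint of
`σ₁, σ₂` and of `μ₁, μ₂` is a linear form in `ξ`, and since `Ň` is affine in `τ` with a slope
depending on `t` only, `g` may replace the values of `Ň` at `σ_j` and at `μ_j` in all three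
conditions.

For (A) ⇒ (B), condition (A) bounds `√(|g| / √(p + 8))` by a constant times
`1 + |∂ₜ log (1 + p^{1/4})|`. Between consecutive critical points of `p(·, ξ)` the integral of the
last term telescopes to at most `log (1 + p^{1/4}) ≲ log (1 + |ξ|)`. The functions `p(·, ξ)` span a
finite dimensional space of analytic functions, so the number of their critical points is bounded
independently of `ξ`: reduce the dimension by dividing by one function and applying Rolle's theorem.

If `n = 1`, then `p = ξ² q(t)` and `g = ξ h(t)`, and (A) and (C) both say that the vanishing order
`k` of `q` and the vanishing order `m` of `h` satisfy `k ≤ 2m + 4` at every point `x` of `[0, T]`.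
If this fails at `x`, then near `x` the integral in (B) concentrates at the distance `|ξ|^{-2/k}`
from `x`, where its size is a positive power of `|ξ|`.
-/

section ZeroCounting

open Set Filter Topology

variable {E : Type*} [NormedAddCommGroup E] [NormedSpace ℝ E] {a b : ℝ}

theorem finite_zeros_of_analyticOnNhd_Icc {f : ℝ → E} (hf : AnalyticOnNhd ℝ f (Icc a b))
    (hne : ∃ t ∈ Icc a b, f t ≠ 0) : {t ∈ Icc a b | f t = 0}.Finite := by
  by_contra hinf
  obtain ⟨x, hx, hacc⟩ := Set.Infinite.exists_accPt_of_subset_isCompact hinf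
    (isCompact_Icc (a := a) (b := b)) (sep_subset _ _)
  obtain ⟨t, ht, hft⟩ := hne
  exact hft (hf.eqOn_zero_of_preconnected_of_frequently_eq_zero isPreconnected_Icc hx
    ((accPt_iff_frequently_nhdsNE.1 hacc).mono fun z hz => hz.2) ht)

theorem encard_le_of_interleaved {A B : Set ℝ}
    (h : ∀ x ∈ A, ∀ y ∈ A, x < y → ∃ z ∈ B, x < z ∧ z < y) : A.encard ≤ B.encard + 1 := by
  rcases B.finite_or_infinite with hB | hB
  · by_contra! hlt
    obtain ⟨G, hGA, hG⟩ := exists_subset_encard_eq (Order.add_one_le_of_lt hlt)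
    have hGfin : G.Finite := finite_of_encard_le_coe (k := hB.toFinset.card + 1 + 1) <| by
      rw [hG, hB.encard_eq_coe_toFinset_card]
      norm_cast
    have hcard : hGfin.toFinset.card ≤ hB.toFinset.card + 1 :=
      Finset.card_le_of_interleaved fun x hx y hy hxy _ => by
        simpa only [hB.mem_toFinset] using h x (hGA (hGfin.mem_toFinset.1 hx)) y
          (hGA (hGfin.mem_toFinset.1 hy)) hxy
    rw [hGfin.encard_eq_coe_toFinset_card, hB.encard_eq_coe_toFinset_card] at hG
    norm_cast at hG
    omega
  · simp [hB.encard_eq]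

/-- The Wronskian `f' g - f g'`, that is, the numerator of the derivative of `f / g`. -/
noncomputable def wronskian (f g : ℝ → ℝ) (t : ℝ) : ℝ := deriv f t * g t - f t * deriv g t

variable {f g : ℝ → ℝ}

theorem analyticOnNhd_wronskian {s : Set ℝ} (hf : AnalyticOnNhd ℝ f s) (hg : AnalyticOnNhd ℝ g s) :
    AnalyticOnNhd ℝ (wronskian f g) s :=
  (hf.deriv.mul hg).sub (hf.mul hg.deriv)

theorem wronskian_sum_mul {ι : Type*} {s : Finset ι} {q : ι → ℝ → ℝ} {t : ℝ}
    (hq : ∀ i ∈ s, DifferentiableAt ℝ (q i) t) (c : ι → ℝ) :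
    wronskian (fun t => ∑ i ∈ s, c i * q i t) g t = ∑ i ∈ s, c i * wronskian (q i) g t := by
  have hderiv : deriv (fun t => ∑ i ∈ s, c i * q i t) t = ∑ i ∈ s, c i * deriv (q i) t :=
    (HasDerivAt.fun_sum fun i hi => (hq i hi).hasDerivAt.const_mul (c i)).deriv
  simp only [wronskian, hderiv, Finset.sum_mul, mul_sub, Finset.sum_sub_distrib, mul_assoc]

theorem hasDerivAt_div_wronskian {t : ℝ} (hf : DifferentiableAt ℝ f t)
    (hg : DifferentiableAt ℝ g t) (h0 : g t ≠ 0) :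
    HasDerivAt (fun s => f s / g s) (wronskian f g t / g t ^ 2) t :=
  hf.hasDerivAt.fun_div hg.hasDerivAt h0

theorem exists_wronskian_eq_zero {x y : ℝ} (hxy : x < y)
    (hf : ∀ t ∈ Icc x y, DifferentiableAt ℝ f t) (hg : ∀ t ∈ Icc x y, DifferentiableAt ℝ g t)
    (h0 : ∀ t ∈ Icc x y, g t ≠ 0) (hfx : f x = 0) (hfy : f y = 0) :
    ∃ z ∈ Ioo x y, wronskian f g z = 0 := by
  have hder : ∀ t ∈ Icc x y, HasDerivAt (fun s => f s / g s) (wronskian f g t / g t ^ 2) t :=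
    fun t ht => hasDerivAt_div_wronskian (hf t ht) (hg t ht) (h0 t ht)
  obtain ⟨z, hz, hz0⟩ := exists_hasDerivAt_eq_zero hxy
    (fun t ht => (hder t ht).continuousAt.continuousWithinAt) (by rw [hfx, hfy, zero_div, zero_div])
    fun t ht => hder t (Ioo_subset_Icc_self ht)
  exact ⟨z, hz, (div_eq_zero_iff.1 hz0).resolve_right
    (pow_ne_zero 2 (h0 z (Ioo_subset_Icc_self hz)))⟩

theorem encard_zeros_le_wronskian (hf : ∀ t ∈ Icc a b, DifferentiableAt ℝ f t)
    (hg : ∀ t ∈ Icc a b, DifferentiableAt ℝ g t) :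
    {t ∈ Icc a b | f t = 0}.encard ≤ {t ∈ Icc a b | g t = 0}.encard +
      {t ∈ Icc a b | wronskian f g t = 0}.encard + 1 + {t ∈ Icc a b | g t = 0}.encard := by
  set Zf := {t ∈ Icc a b | f t = 0}
  set Zg := {t ∈ Icc a b | g t = 0}
  set W := {t ∈ Icc a b | wronskian f g t = 0}
  have hinter : (Zf \ Zg).encard ≤ (Zg ∪ W).encard + 1 := by
    refine encard_le_of_interleaved ?_
    rintro x ⟨⟨hxI, hfx⟩, hgx⟩ y ⟨⟨hyI, hfy⟩, hgy⟩ hxy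
    have hsub : Icc x y ⊆ Icc a b := Icc_subset_Icc hxI.1 hyI.2
    by_cases! hz : ∃ z ∈ Zg, x < z ∧ z < y
    · exact hz.imp fun z hz => ⟨Or.inl hz.1, hz.2⟩
    · have hg0 : ∀ t ∈ Icc x y, g t ≠ 0 := by
        intro t ht hgt
        have htZ : t ∈ Zg := ⟨hsub ht, hgt⟩
        have hxt : x < t := ht.1.lt_of_ne fun h => hgx (h ▸ htZ)
        exact hgy (ht.2.antisymm (hz t htZ hxt) ▸ htZ)
      obtain ⟨z, hz, hWz⟩ := exists_wronskian_eq_zero hxy (fun t ht => hf t (hsub ht))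
        (fun t ht => hg t (hsub ht)) hg0 hfx hfy
      exact ⟨z, Or.inr ⟨hsub (Ioo_subset_Icc_self hz), hWz⟩, hz⟩
  calc Zf.encard ≤ (Zf \ Zg ∪ Zg).encard := encard_le_encard (by simp)
    _ ≤ (Zf \ Zg).encard + Zg.encard := encard_union_le _ _
    _ ≤ (Zg ∪ W).encard + 1 + Zg.encard := by gcongr
    _ ≤ Zg.encard + W.encard + 1 + Zg.encard := by gcongr; exact encard_union_le _ _

theorem eq_zero_of_wronskian_eq_zero (hab : a < b) (hf : AnalyticOnNhd ℝ f (Icc a b))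
    (hg : AnalyticOnNhd ℝ g (Icc a b)) (hw : ∀ t ∈ Icc a b, wronskian f g t = 0)
    {x : ℝ} (hx : x ∈ Icc a b) (hfx : f x = 0) (hgx : g x ≠ 0) : ∀ t ∈ Icc a b, f t = 0 := by
  obtain ⟨ε, hε, hball⟩ :=
    Metric.eventually_nhds_iff_ball.1 ((hg x hx).continuousAt.eventually_ne hgx)
  have hzero : ∀ t ∈ Icc a b ∩ Metric.ball x ε, f t = 0 := by
    intro t ht
    have hder : ∀ s ∈ Icc a b ∩ Metric.ball x ε,
        HasDerivWithinAt (fun s => f s / g s) 0 (Icc a b ∩ Metric.ball x ε) s := by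
      intro s hs
      have hdiv := hasDerivAt_div_wronskian (hf s hs.1).differentiableAt
        (hg s hs.1).differentiableAt (hball s hs.2)
      rw [hw s hs.1, zero_div] at hdiv
      exact hdiv.hasDerivWithinAt
    have hconvex := (convex_Icc a b).inter (convex_ball x ε)
    have hconst := hconvex.norm_image_sub_le_of_norm_hasDerivWithin_le (C := 0) hder (by simp)
      ⟨hx, Metric.mem_ball_self hε⟩ ht
    rw [hfx, zero_div, sub_zero, zero_mul, norm_le_zero_iff] at hconst
    exact (div_eq_zero_iff.1 hconst).resolve_right (hball t ht.2)
  refine hf.eqOn_zero_of_preconnected_of_frequently_eq_zero isPreconnected_Icc hx ?_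
  have hacc := accPt_iff_frequently_nhdsNE.1 ((uniqueDiffOn_Icc hab) x hx).accPt
  have hmem : ∀ᶠ t in 𝓝[≠] x, t ∈ Metric.ball x ε :=
    nhdsWithin_le_nhds (Metric.ball_mem_nhds x hε)
  exact (hacc.and_eventually hmem).mono hzero

theorem eq_zero_or_encard_zeros_le (hab : a < b) (hf : AnalyticOnNhd ℝ f (Icc a b))
    (hg : AnalyticOnNhd ℝ g (Icc a b)) {m n : ℕ∞} (hm : {t ∈ Icc a b | g t = 0}.encard ≤ m)
    (hn : (∀ t ∈ Icc a b, wronskian f g t = 0) ∨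
      {t ∈ Icc a b | wronskian f g t = 0}.encard ≤ n) :
    (∀ t ∈ Icc a b, f t = 0) ∨ {t ∈ Icc a b | f t = 0}.encard ≤ m + n + 1 + m := by
  rcases hn with hW | hn
  · by_cases! hex : ∃ x ∈ Icc a b, f x = 0 ∧ g x ≠ 0
    · obtain ⟨x, hx, hfx, hgx⟩ := hex
      exact Or.inl (eq_zero_of_wronskian_eq_zero hab hf hg hW hx hfx hgx)
    · have hsub : {t ∈ Icc a b | f t = 0} ⊆ {t ∈ Icc a b | g t = 0} :=
        fun t ht => ⟨ht.1, hex t ht.1 ht.2⟩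
      exact Or.inr ((encard_le_encard hsub).trans (hm.trans le_add_self))
  · refine Or.inr ((encard_zeros_le_wronskian (fun t ht => (hf t ht).differentiableAt)
      fun t ht => (hg t ht).differentiableAt).trans ?_)
    gcongr

theorem exists_forall_encard_zeros_sum_le (hab : a < b) {ι : Type*} (s : Finset ι) {q : ι → ℝ → ℝ}
    (hq : ∀ i ∈ s, AnalyticOnNhd ℝ (q i) (Icc a b)) :
    ∃ N : ℕ, ∀ c : ι → ℝ, (∀ t ∈ Icc a b, ∑ i ∈ s, c i * q i t = 0) ∨
      {t ∈ Icc a b | ∑ i ∈ s, c i * q i t = 0}.encard ≤ N := by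
  classical
  induction s using Finset.induction_on generalizing q with
  | empty => exact ⟨0, fun c => Or.inl (by simp)⟩
  | insert i₀ s hi₀ ih =>
    obtain ⟨hq₀, hqs⟩ := Finset.forall_mem_insert .. |>.1 hq
    by_cases! hzero : ∀ t ∈ Icc a b, q i₀ t = 0
    · obtain ⟨N, hN⟩ := ih hqs
      refine ⟨N, fun c => ?_⟩
      have hsum : ∀ t ∈ Icc a b, ∑ i ∈ insert i₀ s, c i * q i t = ∑ i ∈ s, c i * q i t :=
        fun t ht => by rw [Finset.sum_insert hi₀, hzero t ht, mul_zero, zero_add]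
      have hset : {t ∈ Icc a b | ∑ i ∈ insert i₀ s, c i * q i t = 0} =
          {t ∈ Icc a b | ∑ i ∈ s, c i * q i t = 0} :=
        Set.ext fun t => and_congr_right fun ht => by rw [hsum t ht]
      rw [hset]
      exact (hN c).imp_left fun h t ht => (hsum t ht).trans (h t ht)
    · obtain ⟨Z, hZ⟩ := (finite_zeros_of_analyticOnNhd_Icc hq₀ hzero).exists_encard_eq_coe
      obtain ⟨N, hN⟩ := ih fun i hi => analyticOnNhd_wronskian (hqs i hi) hq₀
      refine ⟨Z + N + 1 + Z, fun c => ?_⟩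
      set f : ℝ → ℝ := fun t => ∑ i ∈ insert i₀ s, c i * q i t
      have hf : AnalyticOnNhd ℝ f (Icc a b) :=
        Finset.analyticOnNhd_fun_sum _ fun i hi => analyticOnNhd_const.mul (hq i hi)
      have hw : ∀ t ∈ Icc a b, wronskian f (q i₀) t = ∑ i ∈ s, c i * wronskian (q i) (q i₀) t := by
        intro t ht
        rw [wronskian_sum_mul fun i hi => (hq i hi t ht).differentiableAt, Finset.sum_insert hi₀,
          wronskian, mul_comm (deriv _ t), sub_self, mul_zero, zero_add]
      have hbound := eq_zero_or_encard_zeros_le hab hf hq₀ hZ.le (n := N) <|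
        (hN c).imp (fun h t ht => (hw t ht).trans (h t ht)) fun h => by
          rwa [Set.ext fun t => and_congr_right fun ht => by rw [hw t ht]]
      exact_mod_cast hbound

end ZeroCounting

section IntegralBounds

open Set MeasureTheory

variable {F F' w : ℝ → ℝ} {a b C K : ℝ}

theorem integral_le_of_le_deriv (hab : a ≤ b) (hF : ContinuousOn F (Icc a b))
    (hw : ContinuousOn w (Icc a b)) (hF' : ∀ t ∈ Ioo a b, HasDerivAt F (F' t) t)
    (hpos : ∀ t ∈ Ioo a b, 0 ≤ F' t) (hle : ∀ t ∈ Ioo a b, w t ≤ C + K * F' t) :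
    ∫ t in a..b, w t ≤ C * (b - a) + K * (F b - F a) := by
  have hint : IntervalIntegrable F' volume a b :=
    (intervalIntegrable_iff_integrableOn_Ioc_of_le hab).2
      (intervalIntegral.integrableOn_deriv_of_nonneg hF hF' hpos)
  calc ∫ t in a..b, w t ≤ ∫ t in a..b, (C + K * F' t) :=
        intervalIntegral.integral_mono_on_of_le_Ioo hab (hw.intervalIntegrable_of_Icc hab)
          (intervalIntegrable_const.add (hint.const_mul K)) hle
    _ = C * (b - a) + K * (F b - F a) := by
        rw [intervalIntegral.integral_add intervalIntegrable_const (hint.const_mul K),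
          intervalIntegral.integral_const_mul, intervalIntegral.integral_const, smul_eq_mul,
          intervalIntegral.integral_eq_sub_of_hasDerivAt_of_le hab hF hF' hint, mul_comm C]

variable {B : ℝ}

theorem integral_le_of_le_abs_deriv_of_ne_zero (hab : a ≤ b) (hK : 0 ≤ K)
    (hF : ContinuousOn F (Icc a b)) (hw : ContinuousOn w (Icc a b))
    (hB : ∀ t ∈ Icc a b, F t ∈ Icc 0 B)
    (hF' : ∀ t ∈ Ioo a b, HasDerivAt F (F' t) t ∧ F' t ≠ 0 ∧ w t ≤ C + K * |F' t|) :
    ∫ t in a..b, w t ≤ C * (b - a) + K * B := by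
  obtain ⟨hFa, hFaB⟩ := hB a (left_mem_Icc.2 hab)
  obtain ⟨hFb, hFbB⟩ := hB b (right_mem_Icc.2 hab)
  rcases hasDerivWithinAt_forall_lt_or_forall_gt_of_forall_ne (convex_Ioo a b)
    (fun t ht => (hF' t ht).1.hasDerivWithinAt) (fun t ht => (hF' t ht).2.1) with hneg | hpos
  · have hint : ∫ t in a..b, w t ≤ C * (b - a) + K * (-F b - -F a) :=
      integral_le_of_le_deriv (F' := fun t => -F' t) hab hF.neg hw
        (fun t ht => (hF' t ht).1.neg) (fun t ht => by linarith [hneg t ht])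
        fun t ht => abs_of_neg (hneg t ht) ▸ (hF' t ht).2.2
    nlinarith
  · have hint : ∫ t in a..b, w t ≤ C * (b - a) + K * (F b - F a) :=
      integral_le_of_le_deriv hab hF hw (fun t ht => (hF' t ht).1)
        (fun t ht => (hpos t ht).le) fun t ht => abs_of_pos (hpos t ht) ▸ (hF' t ht).2.2
    nlinarith

theorem integral_le_of_le_abs_deriv (hab : a ≤ b) (hK : 0 ≤ K) (S : Finset ℝ)
    (hF : ContinuousOn F (Icc a b)) (hw : ContinuousOn w (Icc a b))
    (hB : ∀ t ∈ Icc a b, F t ∈ Icc 0 B)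
    (hF' : ∀ t ∈ Ioo a b, t ∉ S → HasDerivAt F (F' t) t ∧ F' t ≠ 0 ∧ w t ≤ C + K * |F' t|) :
    ∫ t in a..b, w t ≤ C * (b - a) + (S.card + 1) * (K * B) := by
  have hB0 : 0 ≤ B := (hB a (left_mem_Icc.2 hab)).1.trans (hB a (left_mem_Icc.2 hab)).2
  induction S using Finset.induction_on_max generalizing b with
  | empty => simpa using integral_le_of_le_abs_deriv_of_ne_zero hab hK hF hw hB (by simpa using hF')
  | insert m s hm ih =>
    rw [Finset.card_insert_of_notMem fun h => (hm m h).false]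
    push_cast
    by_cases hmI : m ∈ Ioo a b
    · have hsub₁ : Icc a m ⊆ Icc a b := Icc_subset_Icc_right hmI.2.le
      have hsub₂ : Icc m b ⊆ Icc a b := Icc_subset_Icc_left hmI.1.le
      have hleft : ∫ t in a..m, w t ≤ C * (m - a) + (s.card + 1) * (K * B) :=
        ih hmI.1.le (hF.mono hsub₁) (hw.mono hsub₁) (fun t ht => hB t (hsub₁ ht))
          fun t ht hts => hF' t ⟨ht.1, ht.2.trans hmI.2⟩ (by simp [ht.2.ne, hts])
      have hright : ∫ t in m..b, w t ≤ C * (b - m) + K * B :=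
        integral_le_of_le_abs_deriv_of_ne_zero hmI.2.le hK (hF.mono hsub₂) (hw.mono hsub₂)
          (fun t ht => hB t (hsub₂ ht)) fun t ht => hF' t ⟨hmI.1.trans ht.1, ht.2⟩ (by
            simpa [ht.1.ne'] using fun hts => (hm t hts).not_gt ht.1)
      rw [← intervalIntegral.integral_add_adjacent_intervals
        ((hw.mono hsub₁).intervalIntegrable_of_Icc hmI.1.le)
        ((hw.mono hsub₂).intervalIntegrable_of_Icc hmI.2.le)]
      linarith
    · have hint := ih hab hF hw hB fun t ht hts => hF' t ht (by
        simpa [hts] using fun h : t = m => hmI (h ▸ ht))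
      linarith [mul_nonneg hK hB0]

end IntegralBounds

section LeviDensity

open Set

/-- The right-hand side `√p + p'² / p^(3/2)` of the pointwise condition (A), for a discriminant
`p`. -/
noncomputable def leviMajorant (p : ℝ → ℝ) (t : ℝ) : ℝ :=
  √(p t) + deriv p t ^ 2 / (p t * √(p t))

variable {F : Type*} [NormedAddCommGroup F]

/-- The integrand `√(|g| / √(p + 8))` of the Levi condition (B), when `Δ = p` and both
`Ň(t, μ₁, ξ)` and `Ň(t, μ₂, ξ)` are replaced by `g`; indeed `μ₂ - μ₁ = √(Δ + 8)`. -/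
noncomputable def leviDensity (p : ℝ → ℝ) (g : ℝ → F) (t : ℝ) : ℝ := √(‖g t‖ / √(p t + 8))

variable {p : ℝ → ℝ} {g : ℝ → F} {a b t : ℝ}

theorem leviMajorant_sq_mul (c : ℝ) (p : ℝ → ℝ) (t : ℝ) :
    leviMajorant (fun s => c ^ 2 * p s) t = |c| * leviMajorant p t := by
  rcases eq_or_ne c 0 with rfl | hc
  · simp [leviMajorant]
  · have hsqrt : √(c ^ 2 * p t) = |c| * √(p t) := by
      rw [Real.sqrt_mul (sq_nonneg c), Real.sqrt_sq_eq_abs]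
    rw [leviMajorant, leviMajorant, hsqrt, deriv_const_mul_field', mul_add, ← sq_abs c]
    have habs : |c| ≠ 0 := abs_ne_zero.2 hc
    congr 1
    rw [show (|c| ^ 2 * deriv p t) ^ 2 = |c| ^ 3 * (|c| * deriv p t ^ 2) by ring,
      show |c| ^ 2 * p t * (|c| * √(p t)) = |c| ^ 3 * (p t * √(p t)) by ring,
      mul_div_mul_left _ _ (pow_ne_zero 3 habs), mul_div_assoc]

theorem leviMajorant_congr {q : ℝ → ℝ} (h : p =ᶠ[nhds t] q) :
    leviMajorant p t = leviMajorant q t := by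
  rw [leviMajorant, leviMajorant, h.deriv_eq, h.eq_of_nhds]

theorem sqrt_le_leviMajorant (h : 0 ≤ p t) : √(p t) ≤ leviMajorant p t :=
  le_add_of_nonneg_right (by positivity)

theorem continuousOn_leviDensity {s : Set ℝ} (hp : ContinuousOn p s) (hp0 : ∀ t ∈ s, 0 ≤ p t)
    (hg : ContinuousOn g s) : ContinuousOn (leviDensity p g) s :=
  (hg.norm.div (hp.add continuousOn_const).sqrt fun t ht =>
    (Real.sqrt_pos.2 (add_pos_of_nonneg_of_pos (hp0 t ht) (by norm_num))).ne').sqrt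

theorem leviDensity_nonneg (p : ℝ → ℝ) (g : ℝ → F) (t : ℝ) : 0 ≤ leviDensity p g t :=
  Real.sqrt_nonneg _

theorem leviDensity_le_add {g₁ g₂ : ℝ → F} (h : ‖g t‖ ≤ ‖g₁ t‖ + ‖g₂ t‖) :
    leviDensity p g t ≤ leviDensity p g₁ t + leviDensity p g₂ t := by
  refine Real.sqrt_le_iff.2 ⟨by unfold leviDensity; positivity, ?_⟩
  rw [leviDensity, leviDensity, add_sq', Real.sq_sqrt (by positivity), Real.sq_sqrt (by positivity),
    ← add_div]
  refine le_add_of_le_of_nonneg ?_ (by positivity)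
  gcongr

theorem hasDerivAt_log_one_add_sqrt_sqrt {p' : ℝ} (hp : HasDerivAt p p' t) (hpos : 0 < p t) :
    HasDerivAt (fun s => Real.log (1 + √√(p s)))
      (p' / (4 * √√(p t) ^ 3 * (1 + √√(p t)))) t := by
  have hsqrt : √(p t) = √√(p t) ^ 2 := (Real.sq_sqrt (Real.sqrt_nonneg _)).symm
  have hsqrt_pos : 0 < √√(p t) := by positivity
  have hlog := (((hp.sqrt hpos.ne').sqrt (by positivity)).const_add 1).log (by positivity)
  refine hlog.congr_deriv ?_
  rw [hsqrt, Real.sqrt_sq hsqrt_pos.le]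
  field_simp
  norm_num

theorem sqrt_div_sqrt_pow_four_add_le {y d G C : ℝ} (hy : 0 < y) (hC : 0 ≤ C)
    (hG : G ≤ C * (y ^ 2 + d ^ 2 / y ^ 6)) :
    √(G / √(y ^ 4 + 8)) ≤ √C + 8 * √C * |d / (4 * y ^ 3 * (1 + y))| := by
  set s := √(y ^ 4 + 8)
  set z := 8 * |d / (4 * y ^ 3 * (1 + y))|
  have hy_le : y ^ 2 ≤ s := Real.le_sqrt_of_sq_le (by nlinarith)
  have hone_le : (1 + y) ^ 2 / 4 ≤ s := Real.le_sqrt_of_sq_le (by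
    nlinarith [sq_nonneg (y - 1), sq_nonneg (y ^ 2 - 1), sq_nonneg (y ^ 2 - y), sq_nonneg y])
  have hs : 0 < s := by positivity
  have hz : 0 ≤ z := by positivity
  have hd : d ^ 2 / y ^ 6 = z ^ 2 * ((1 + y) ^ 2 / 4) := by
    simp only [z, mul_pow, sq_abs]
    field_simp
    norm_num
  have hle : G / s ≤ C * (1 + z) ^ 2 := by
    rw [div_le_iff₀ hs]
    calc G ≤ C * (y ^ 2 + z ^ 2 * ((1 + y) ^ 2 / 4)) := by rwa [← hd]
      _ ≤ C * (s + z ^ 2 * s) := by gcongr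
      _ ≤ C * (1 + z) ^ 2 * s := by
        nlinarith [mul_nonneg hC (mul_nonneg hz hs.le)]
  calc √(G / s) ≤ √(C * (1 + z) ^ 2) := Real.sqrt_le_sqrt hle
    _ = √C * (1 + z) := by rw [Real.sqrt_mul hC, Real.sqrt_sq (by positivity)]
    _ = _ := by ring

theorem leviDensity_le {C : ℝ} (hp : 0 < p t) (hC : 0 ≤ C) (hg : ‖g t‖ ≤ C * leviMajorant p t) :
    leviDensity p g t ≤
      √C + 8 * √C * |deriv p t / (4 * √√(p t) ^ 3 * (1 + √√(p t)))| := by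
  have hsqrt : √(p t) = √√(p t) ^ 2 := (Real.sq_sqrt (Real.sqrt_nonneg _)).symm
  have hpow : p t = √√(p t) ^ 4 := by
    rw [show √√(p t) ^ 4 = (√√(p t) ^ 2) ^ 2 by ring, ← hsqrt, Real.sq_sqrt hp.le]
  have hmul : p t * √(p t) = √√(p t) ^ 6 := by
    linear_combination √(p t) * hpow + √√(p t) ^ 4 * hsqrt
  have hmaj : leviMajorant p t = √√(p t) ^ 2 + deriv p t ^ 2 / √√(p t) ^ 6 := by
    rw [leviMajorant, hmul, ← hsqrt]
  have hle := sqrt_div_sqrt_pow_four_add_le (by positivity : 0 < √√(p t)) hC (hmaj ▸ hg)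
  rwa [← hpow] at hle

theorem log_one_add_sqrt_sqrt_le {K x c : ℝ} (hK : 0 ≤ K) (hx : 1 ≤ x) (hc : c ≤ K * x ^ 2) :
    Real.log (1 + √√c) ≤ (Real.log (1 + √K) / Real.log 2 + 1) * Real.log (1 + x) := by
  have hlog2 : 0 < Real.log 2 := Real.log_pos (by norm_num)
  have hlog2x : Real.log 2 ≤ Real.log (1 + x) := Real.log_le_log (by norm_num) (by linarith)
  have hlogK : 0 ≤ Real.log (1 + √K) := Real.log_nonneg (by linarith [Real.sqrt_nonneg K])
  have hsqrt : √c ≤ √K * x := by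
    calc √c ≤ √(K * x ^ 2) := Real.sqrt_le_sqrt hc
      _ = √K * x := by rw [Real.sqrt_mul hK, Real.sqrt_sq (by linarith)]
  have hsqrt_sqrt : √√c ≤ √K + x := by
    refine Real.sqrt_le_iff.2 ⟨by positivity, hsqrt.trans ?_⟩
    nlinarith [Real.sqrt_nonneg K, sq_nonneg (√K)]
  calc Real.log (1 + √√c) ≤ Real.log ((1 + √K) * (1 + x)) :=
        Real.log_le_log (by positivity) (by nlinarith [Real.sqrt_nonneg K])
    _ = Real.log (1 + √K) / Real.log 2 * Real.log 2 + Real.log (1 + x) := by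
        rw [Real.log_mul (by positivity) (by positivity), div_mul_cancel₀ _ hlog2.ne']
    _ ≤ Real.log (1 + √K) / Real.log 2 * Real.log (1 + x) + Real.log (1 + x) := by gcongr
    _ = (Real.log (1 + √K) / Real.log 2 + 1) * Real.log (1 + x) := by ring

variable {B C : ℝ}

theorem integral_leviDensity_le_of_deriv_eq_zero (hab : a ≤ b) (hC : 0 ≤ C)
    (hp : ∀ t ∈ Icc a b, DifferentiableAt ℝ p t) (hp0 : ∀ t ∈ Icc a b, 0 ≤ p t)
    (hg : ContinuousOn g (Icc a b))
    (hgp : ∀ t ∈ Icc a b, p t ≠ 0 → ‖g t‖ ≤ C * leviMajorant p t)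
    (hg0 : (∀ t ∈ Icc a b, p t = 0) → ∀ t ∈ Icc a b, g t = 0)
    (hp' : ∀ t ∈ Icc a b, deriv p t = 0) :
    ∫ t in a..b, leviDensity p g t ≤ √C * (b - a) := by
  have hpc : ContinuousOn p (Icc a b) := fun t ht => (hp t ht).continuousAt.continuousWithinAt
  have hconst : ∀ t ∈ Icc a b, p t = p a := constant_of_has_deriv_right_zero hpc fun t ht =>
    hp' t (Ico_subset_Icc_self ht) ▸ (hp t (Ico_subset_Icc_self ht)).hasDerivAt.hasDerivWithinAt
  have hle : ∀ t ∈ Icc a b, leviDensity p g t ≤ √C := by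
    intro t ht
    by_cases hpa : p a = 0
    · simp [leviDensity, hg0 (fun s hs => (hconst s hs).trans hpa) t ht]
    · have hpt : p t ≠ 0 := hconst t ht ▸ hpa
      simpa [hp' t ht] using leviDensity_le ((hp0 t ht).lt_of_ne' hpt) hC (hgp t ht hpt)
  have hint : ∫ t in a..b, leviDensity p g t ≤ ∫ _ in a..b, √C :=
    intervalIntegral.integral_mono_on hab
      ((continuousOn_leviDensity hpc hp0 hg).intervalIntegrable_of_Icc hab)
      intervalIntegrable_const hle
  rwa [intervalIntegral.integral_const, smul_eq_mul, mul_comm] at hint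

theorem integral_leviDensity_le (hab : a ≤ b) (hC : 0 ≤ C)
    (hp : ∀ t ∈ Icc a b, DifferentiableAt ℝ p t) (hp0 : ∀ t ∈ Icc a b, 0 ≤ p t)
    (hg : ContinuousOn g (Icc a b))
    (hgp : ∀ t ∈ Icc a b, p t ≠ 0 → ‖g t‖ ≤ C * leviMajorant p t)
    (hB : ∀ t ∈ Icc a b, Real.log (1 + √√(p t)) ≤ B) {N : ℕ}
    (hN : {t ∈ Icc a b | deriv p t = 0}.encard ≤ N) :
    ∫ t in a..b, leviDensity p g t ≤ √C * (b - a) + (N + 1) * (8 * √C * B) := by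
  have hpc : ContinuousOn p (Icc a b) := fun t ht => (hp t ht).continuousAt.continuousWithinAt
  have hlog : ∀ t ∈ Icc a b, Real.log (1 + √√(p t)) ∈ Icc 0 B := fun t ht =>
    ⟨Real.log_nonneg (by linarith [Real.sqrt_nonneg √(p t)]), hB t ht⟩
  have hB0 : 0 ≤ B := (hlog a (left_mem_Icc.2 hab)).1.trans (hlog a (left_mem_Icc.2 hab)).2
  have hfin := finite_of_encard_le_coe hN
  rw [hfin.encard_eq_coe_toFinset_card, Nat.cast_le] at hN
  have hint := integral_le_of_le_abs_deriv hab (K := 8 * √C) (by positivity) hfin.toFinset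
    (F := fun t => Real.log (1 + √√(p t)))
    ((continuousOn_const.add hpc.sqrt.sqrt).log fun t _ =>
      (by positivity : (1 : ℝ) + √√(p t) ≠ 0))
    (continuousOn_leviDensity hpc hp0 hg) hlog (C := √C)
    (F' := fun t => deriv p t / (4 * √√(p t) ^ 3 * (1 + √√(p t)))) fun t ht hts => by
      have htI := Ioo_subset_Icc_self ht
      have hp't : deriv p t ≠ 0 := fun h => hts (hfin.mem_toFinset.2 ⟨htI, h⟩)
      have hpt : p t ≠ 0 := fun h => hp't <| IsLocalMin.deriv_eq_zero <| by
        filter_upwards [Ioo_mem_nhds ht.1 ht.2] with s hs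
        exact h ▸ hp0 s (Ioo_subset_Icc_self hs)
      have hpos : 0 < p t := (hp0 t htI).lt_of_ne' hpt
      exact ⟨hasDerivAt_log_one_add_sqrt_sqrt (hp t htI).hasDerivAt hpos,
        div_ne_zero hp't (by positivity), leviDensity_le hpos hC (hgp t htI hpt)⟩
  refine hint.trans ?_
  gcongr

end LeviDensity

section QuadraticFamilies

open Set Filter Asymptotics QuadraticMap

theorem associated_eq_inv_two_mul {V : Type*} [AddCommGroup V] [Module ℝ V]
    (Q : QuadraticForm ℝ V) (x y : V) :
    associated Q x y = 2⁻¹ * (Q (x + y) - Q x - Q y) := by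
  have h : 2 • associated Q x y = Q (x + y) - Q x - Q y :=
    LinearMap.congr_fun₂ (two_nsmul_associated ℝ Q) x y
  rw [← h, nsmul_eq_mul, Nat.cast_ofNat, inv_mul_cancel_left₀ two_ne_zero]

theorem map_add_smul_of_map_eq_zero {V : Type*} [AddCommGroup V] [Module ℝ V]
    {Q : QuadraticForm ℝ V} (hQ : ∀ x, 0 ≤ Q x) {x : V} (hx : Q x = 0) (y : V) (ε : ℝ) :
    Q (x + ε • y) = ε ^ 2 * Q y := by
  have hcauchy : associated Q x y ^ 2 ≤ associated Q x x * associated Q y y :=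
    LinearMap.BilinForm.apply_sq_le_of_symm _
      (fun z => (associated_eq_self_apply ℝ Q z).symm ▸ hQ z) ⟨associated_isSymm ℝ Q⟩ x y
  have hassoc : associated Q x y = 0 := by
    rw [associated_eq_self_apply, hx, zero_mul] at hcauchy
    exact pow_eq_zero_iff two_ne_zero |>.1 (hcauchy.antisymm (sq_nonneg _))
  have hpolar : polar Q x y = 0 := by
    rw [associated_eq_inv_two_mul] at hassoc
    exact (mul_eq_zero_iff_left (by norm_num)).1 hassoc
  rw [QuadraticMap.map_add Q, QuadraticMap.map_smul, polar_smul_right, hpolar, hx]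
  simp [pow_two]

theorem map_eq_sum_associated {V ι : Type*} [AddCommGroup V] [Module ℝ V] [Fintype ι]
    (Q : QuadraticForm ℝ V) (b : Module.Basis ι ℝ V) (x : V) :
    Q x = ∑ i : ι × ι, b.repr x i.1 * b.repr x i.2 * associated Q (b i.1) (b i.2) := by
  conv_lhs => rw [← associated_eq_self_apply ℝ Q x, ← b.sum_repr x]
  simp only [map_sum, map_smul, LinearMap.sum_apply, LinearMap.smul_apply, smul_eq_mul,
    Fintype.sum_prod_type, mul_assoc, Finset.mul_sum]
  refine Finset.sum_congr rfl fun i _ => Finset.sum_congr rfl fun j _ => ?_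
  rw [associated_isSymm ℝ Q (b j) (b i)]

variable {V : Type*} [NormedAddCommGroup V] [NormedSpace ℝ V] [FiniteDimensional ℝ V]
  {Q : ℝ → QuadraticForm ℝ V} {a b : ℝ}

theorem exists_forall_encard_critical_le (hab : a < b)
    (hQ : ∀ ξ, AnalyticOnNhd ℝ (fun t => Q t ξ) (Icc a b)) :
    ∃ N : ℕ, ∀ ξ, (∀ t ∈ Icc a b, deriv (fun s => Q s ξ) t = 0) ∨
      {t ∈ Icc a b | deriv (fun s => Q s ξ) t = 0}.encard ≤ N := by
  let B := Module.finBasis ℝ V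
  let q : Fin _ × Fin _ → ℝ → ℝ := fun i t => associated (Q t) (B i.1) (B i.2)
  have hq : ∀ i, AnalyticOnNhd ℝ (q i) (Icc a b) := fun i => by
    simp only [q, associated_eq_inv_two_mul]
    exact analyticOnNhd_const.mul (((hQ _).sub (hQ _)).sub (hQ _))
  obtain ⟨N, hN⟩ := exists_forall_encard_zeros_sum_le hab Finset.univ (q := fun i => deriv (q i))
    fun i _ => (hq i).deriv
  refine ⟨N, fun ξ => ?_⟩
  have hderiv : ∀ t ∈ Icc a b, deriv (fun s => Q s ξ) t =
      ∑ i, B.repr ξ i.1 * B.repr ξ i.2 * deriv (q i) t := by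
    intro t ht
    rw [funext fun s => map_eq_sum_associated (Q s) B ξ]
    exact (HasDerivAt.fun_sum fun i _ =>
      (hq i t ht).differentiableAt.hasDerivAt.const_mul _).deriv
  refine (hN fun i => B.repr ξ i.1 * B.repr ξ i.2).imp
    (fun h t ht => (hderiv t ht).trans (h t ht)) fun h => ?_
  rwa [Set.ext fun t => and_congr_right fun ht => by rw [hderiv t ht]]

theorem quadraticForm_isBigO_norm_sq (hQ : ∀ ξ, ContinuousOn (fun t => Q t ξ) (Icc a b)) :
    (fun z : ℝ × V => Q z.1 z.2) =O[𝓟 (Icc a b ×ˢ univ)] fun z => ‖z.2‖ ^ 2 := by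
  let B := Module.finBasis ℝ V
  have hcoord : ∀ i, (fun z : ℝ × V => B.repr z.2 i) =O[𝓟 (Icc a b ×ˢ univ)] fun z => ‖z.2‖ :=
    fun i => ((B.coord i).toContinuousLinearMap.isBigO_comp Prod.snd _).norm_right
  have hcoeff : ∀ i j, (fun z : ℝ × V => associated (Q z.1) (B i) (B j))
      =O[𝓟 (Icc a b ×ˢ univ)] fun _ => (1 : ℝ) := by
    intro i j
    have hcont : ContinuousOn (fun t => associated (Q t) (B i) (B j)) (Icc a b) := by
      simp only [associated_eq_inv_two_mul]
      exact continuousOn_const.mul (((hQ _).sub (hQ _)).sub (hQ _))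
    refine (hcont.isBigO_principal isCompact_Icc (c := (1 : ℝ)) (by simp)).comp_tendsto ?_
    exact tendsto_principal_principal.2 fun z hz => hz.1
  refine (IsBigO.sum (s := .univ) fun (i : Fin _ × Fin _) _ =>
    ((hcoord i.1).mul (hcoord i.2)).mul (hcoeff i.1 i.2)).congr (fun z => ?_) fun z => by
      rw [mul_one, pow_two]
  rw [map_eq_sum_associated (Q z.1) B z.2, Finset.sum_apply]

end QuadraticFamilies

section DegenerateDirections

open Set Filter Topology

variable {V F : Type*} [AddCommGroup V] [Module ℝ V] [NormedAddCommGroup F] [NormedSpace ℝ F]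
  {Q : ℝ → QuadraticForm ℝ V} {ℓ : ℝ → V →ₗ[ℝ] F} {a b C : ℝ} {ξ η : V}

theorem leviMajorant_add_smul (hQ0 : ∀ t ∈ Icc a b, ∀ ξ, 0 ≤ Q t ξ)
    (hξ : ∀ t ∈ Icc a b, Q t ξ = 0) (η : V) (ε : ℝ) {t : ℝ} (ht : t ∈ Ioo a b) :
    leviMajorant (fun s => Q s (ξ + ε • η)) t = |ε| * leviMajorant (fun s => Q s η) t := by
  rw [← leviMajorant_sq_mul]
  refine leviMajorant_congr ?_
  filter_upwards [Icc_mem_nhds ht.1 ht.2] with s hs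
  exact map_add_smul_of_map_eq_zero (hQ0 s hs) (hξ s hs) η ε

theorem linear_eq_zero_of_quadratic_eq_zero (hQ0 : ∀ t ∈ Icc a b, ∀ ξ, 0 ≤ Q t ξ)
    (hC : ∀ t ∈ Icc a b, ∀ ξ, Q t ξ ≠ 0 → ‖ℓ t ξ‖ ≤ C * leviMajorant (fun s => Q s ξ) t)
    (hξ : ∀ t ∈ Icc a b, Q t ξ = 0) {t : ℝ} (ht : t ∈ Ioo a b) (hη : Q t η ≠ 0) :
    ℓ t ξ = 0 := by
  have htI := Ioo_subset_Icc_self ht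
  set R := C * leviMajorant (fun s => Q s η) t + ‖ℓ t η‖
  have hle : ∀ ε > 0, ‖ℓ t ξ‖ ≤ ε * R := by
    intro ε hε
    have hne : Q t (ξ + ε • η) ≠ 0 := by
      rw [map_add_smul_of_map_eq_zero (hQ0 t htI) (hξ t htI)]
      positivity
    have hbound := hC t htI (ξ + ε • η) hne
    rw [leviMajorant_add_smul hQ0 hξ η ε ht, abs_of_pos hε, map_add, map_smul] at hbound
    calc ‖ℓ t ξ‖ = ‖ℓ t ξ + ε • ℓ t η - ε • ℓ t η‖ := by rw [add_sub_cancel_right]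
      _ ≤ ‖ℓ t ξ + ε • ℓ t η‖ + ‖ε • ℓ t η‖ := norm_sub_le _ _
      _ ≤ C * (ε * leviMajorant (fun s => Q s η) t) + ε * ‖ℓ t η‖ := by
        rw [norm_smul, Real.norm_of_nonneg hε.le]
        gcongr
      _ = ε * R := by ring
  have hlim : Tendsto (fun ε : ℝ => ε * R) (𝓝[>] 0) (𝓝 0) :=
    ((continuous_mul_const R).tendsto' 0 0 (zero_mul R)).mono_left nhdsWithin_le_nhds
  exact norm_le_zero_iff.1 (ge_of_tendsto hlim (eventually_mem_nhdsWithin.mono hle))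

theorem linear_eq_zero_of_quadratic_eq_zero_on_Icc (hab : a < b)
    (hQ : AnalyticOnNhd ℝ (fun t => Q t η) (Icc a b)) (hQ0 : ∀ t ∈ Icc a b, ∀ ξ, 0 ≤ Q t ξ)
    (hℓ : AnalyticOnNhd ℝ (fun t => ℓ t ξ) (Icc a b))
    (hC : ∀ t ∈ Icc a b, ∀ ξ, Q t ξ ≠ 0 → ‖ℓ t ξ‖ ≤ C * leviMajorant (fun s => Q s ξ) t)
    (hξ : ∀ t ∈ Icc a b, Q t ξ = 0) (hη : ∃ t ∈ Icc a b, Q t η ≠ 0) :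
    ∀ t ∈ Icc a b, ℓ t ξ = 0 := by
  by_contra! hne
  refine Ioo_infinite hab (((finite_zeros_of_analyticOnNhd_Icc hQ hη).union
    (finite_zeros_of_analyticOnNhd_Icc hℓ hne)).subset fun t ht => ?_)
  have htI := Ioo_subset_Icc_self ht
  by_cases hηt : Q t η = 0
  · exact Or.inl ⟨htI, hηt⟩
  · exact Or.inr ⟨htI, linear_eq_zero_of_quadratic_eq_zero hQ0 hC hξ ht hηt⟩

end DegenerateDirections

section UniformLevi

open Set Asymptotics

variable {V F : Type*} [NormedAddCommGroup V] [NormedSpace ℝ V] [FiniteDimensional ℝ V]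
  [NormedAddCommGroup F] [NormedSpace ℝ F] {Q : ℝ → QuadraticForm ℝ V} {ℓ : ℝ → V →ₗ[ℝ] F}
  {a b C : ℝ}

theorem exists_integral_leviDensity_le (hab : a < b)
    (hQ : ∀ ξ, AnalyticOnNhd ℝ (fun t => Q t ξ) (Icc a b)) (hQ0 : ∀ t ∈ Icc a b, ∀ ξ, 0 ≤ Q t ξ)
    (hℓ : ∀ ξ, AnalyticOnNhd ℝ (fun t => ℓ t ξ) (Icc a b))
    (hne : ∃ t ∈ Icc a b, ∃ η, Q t η ≠ 0) (hC : 0 ≤ C)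
    (hlevi : ∀ t ∈ Icc a b, ∀ ξ, Q t ξ ≠ 0 → ‖ℓ t ξ‖ ≤ C * leviMajorant (fun s => Q s ξ) t) :
    ∃ D, ∀ ξ, 1 ≤ ‖ξ‖ → ∫ t in a..b, leviDensity (fun s => Q s ξ) (fun s => ℓ s ξ) t ≤
      D * Real.log (1 + ‖ξ‖) := by
  obtain ⟨t₀, ht₀, η, hη⟩ := hne
  obtain ⟨K, hK0, hK⟩ :=
    (quadraticForm_isBigO_norm_sq fun ξ => (hQ ξ).continuousOn).exists_nonneg
  obtain ⟨N, hN⟩ := exists_forall_encard_critical_le hab hQ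
  set M := Real.log (1 + √K) / Real.log 2 + 1
  have hlog2 : 0 < Real.log 2 := Real.log_pos (by norm_num)
  have hM : 0 ≤ M := by
    have hlogK : 0 ≤ Real.log (1 + √K) := Real.log_nonneg (by linarith [Real.sqrt_nonneg K])
    positivity
  refine ⟨√C * (b - a) / Real.log 2 + (N + 1) * (8 * √C * M), fun ξ hξ => ?_⟩
  have hlog : Real.log 2 ≤ Real.log (1 + ‖ξ‖) := Real.log_le_log (by norm_num) (by linarith)
  have hlogξ : 0 ≤ Real.log (1 + ‖ξ‖) := hlog2.le.trans hlog
  have hB : ∀ t ∈ Icc a b, Real.log (1 + √√(Q t ξ)) ≤ M * Real.log (1 + ‖ξ‖) := fun t ht =>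
    log_one_add_sqrt_sqrt_le hK0 hξ <| by
      simpa [abs_of_nonneg (hQ0 t ht ξ)] using isBigOWith_principal.1 hK (t, ξ) ⟨ht, mem_univ _⟩
  have hdiff : ∀ t ∈ Icc a b, DifferentiableAt ℝ (fun s => Q s ξ) t :=
    fun t ht => (hQ ξ t ht).differentiableAt
  have hint : ∫ t in a..b, leviDensity (fun s => Q s ξ) (fun s => ℓ s ξ) t ≤
      √C * (b - a) + (N + 1) * (8 * √C * (M * Real.log (1 + ‖ξ‖))) := by
    rcases hN ξ with hconst | hcrit
    · refine (integral_leviDensity_le_of_deriv_eq_zero hab.le hC hdiff (fun t ht => hQ0 t ht ξ)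
        (hℓ ξ).continuousOn (fun t ht => hlevi t ht ξ) (fun hzero =>
          linear_eq_zero_of_quadratic_eq_zero_on_Icc hab (hQ η) hQ0 (hℓ ξ) hlevi hzero
            ⟨t₀, ht₀, hη⟩) hconst).trans (le_add_of_nonneg_right (by positivity))
    · exact integral_leviDensity_le hab.le hC hdiff (fun t ht => hQ0 t ht ξ)
        (hℓ ξ).continuousOn (fun t ht => hlevi t ht ξ) hB hcrit
  have hlen : √C * (b - a) ≤ √C * (b - a) / Real.log 2 * Real.log (1 + ‖ξ‖) := by
    rw [div_mul_eq_mul_div, le_div_iff₀ hlog2]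
    exact mul_le_mul_of_nonneg_left hlog (mul_nonneg (Real.sqrt_nonneg C) (sub_nonneg.2 hab.le))
  linear_combination hint + hlen

end UniformLevi

section VanishingOrders

open Set Filter Topology Asymptotics

variable {E F : Type*} [NormedAddCommGroup E] [NormedAddCommGroup F] [NormedSpace ℝ F]

theorem isBigO_principal_of_forall_nhdsWithin {X : Type*} [TopologicalSpace X] {s K : Set X}
    {f : X → E} {g : X → ℝ} (hK : IsCompact K) (hsK : s ⊆ K)
    (h : ∀ x ∈ K, f =O[𝓝[s] x] g) : f =O[𝓟 s] g := by
  suffices f =O[𝓟 (s ∩ K)] g by rwa [inter_eq_left.2 hsK] at this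
  refine hK.induction_on (p := fun U => f =O[𝓟 (s ∩ U)] g) (by simp)
    (fun U V hUV hV => hV.mono (principal_mono.2 (inter_subset_inter_right s hUV)))
    (fun U V hU hV => ?_) fun x hx => ?_
  · rw [inter_union_distrib_left, ← sup_principal]
    exact hU.sup hV
  · obtain ⟨C, hC⟩ := (h x hx).bound
    obtain ⟨U, hU, hUC⟩ := mem_nhdsWithin_iff_exists_mem_nhds_inter.1 hC
    exact ⟨U, mem_nhdsWithin_of_mem_nhds hU,
      IsBigO.of_bound C fun y hy => hUC ⟨hy.2, hy.1⟩⟩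

theorem isBigO_nhdsWithin_of_ne_zero {X : Type*} [TopologicalSpace X] {s : Set X} {x : X}
    {f : X → E} {g : X → ℝ} (hf : ContinuousWithinAt f s x) (hg : ContinuousWithinAt g s x)
    (hgx : g x ≠ 0) : f =O[𝓝[s] x] g :=
  (hf.tendsto.isBigO_one ℝ).trans <|
    (isBigO_const_left_iff_pos_le_norm one_ne_zero).2
      ⟨‖g x‖ / 2, half_pos (norm_pos_iff.2 hgx),
        (hg.norm.eventually (lt_mem_nhds (half_lt_self (norm_pos_iff.2 hgx)))).mono
          fun _ h => h.le⟩

theorem pow_sub_isBigO_pow_sub (x : ℝ) {j k : ℕ} (hjk : j ≤ k) :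
    (fun t => (t - x) ^ k) =O[𝓝 x] fun t => (t - x) ^ j := by
  have hone : (fun t => (t - x) ^ (k - j)) =O[𝓝 x] fun _ => (1 : ℝ) :=
    (Continuous.tendsto (by fun_prop) x).isBigO_one ℝ
  refine ((isBigO_refl _ _).mul hone).congr (fun t => ?_) fun t => mul_one _
  rw [← pow_add, Nat.add_sub_cancel' hjk]

theorem isTheta_pow_analyticOrderNatAt {f : ℝ → F} {x : ℝ} (hf : AnalyticAt ℝ f x)
    (hne : analyticOrderAt f x ≠ ⊤) :
    f =Θ[𝓝 x] fun t => (t - x) ^ analyticOrderNatAt f x := by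
  obtain ⟨u, hu, hux, hfu⟩ := hf.analyticOrderAt_ne_top.1 hne
  have hu_one : u =Θ[𝓝 x] fun _ => (1 : ℝ) := by
    simp only [← nhdsWithin_univ]
    refine ⟨isBigO_nhdsWithin_of_ne_zero hu.continuousAt.continuousWithinAt
      continuousWithinAt_const one_ne_zero, ?_⟩
    exact (isBigO_nhdsWithin_of_ne_zero (f := fun _ => (1 : ℝ)) continuousWithinAt_const
      hu.continuousAt.norm.continuousWithinAt (norm_ne_zero_iff.2 hux)).of_norm_right
  refine hfu.trans_isTheta ?_
  simpa using (isTheta_refl (fun t => (t - x) ^ analyticOrderNatAt f x) (𝓝 x)).smul hu_one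

theorem isBigO_sub_mul_deriv {q : ℝ → ℝ} {x : ℝ} (hq : AnalyticAt ℝ q x) (hqx : q x = 0) :
    q =O[𝓝 x] fun t => (t - x) * deriv q t := by
  have horder : analyticOrderAt (deriv q) x + 1 = analyticOrderAt q x := by
    simpa [hqx] using hq.analyticOrderAt_deriv_add_one
  by_cases htop : analyticOrderAt q x = ⊤
  · exact (isBigO_zero _ _).congr' (EventuallyEq.symm (analyticOrderAt_eq_top.1 htop))
      EventuallyEq.rfl
  · have htop' : analyticOrderAt (deriv q) x ≠ ⊤ := fun h => htop (by rw [← horder, h, top_add])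
    have hnat : analyticOrderNatAt q x = analyticOrderNatAt (deriv q) x + 1 := by
      rw [← Nat.cast_analyticOrderNatAt htop, ← Nat.cast_analyticOrderNatAt htop'] at horder
      exact_mod_cast horder.symm
    refine (isTheta_pow_analyticOrderNatAt hq htop).isBigO.trans ?_
    simp only [hnat, pow_succ']
    exact (isBigO_refl _ _).mul (isTheta_pow_analyticOrderNatAt hq.deriv htop').symm.isBigO

end VanishingOrders

section LocalLevi

open Set Filter Topology Asymptotics

variable {F : Type*} [NormedAddCommGroup F] [NormedSpace ℝ F] {q : ℝ → ℝ} {h : ℝ → F}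
  {a b x : ℝ}

theorem sq_smul_isBigO_sqrt_of_order_le {s : Set ℝ} {k m : ℕ} (hkm : k ≤ 2 * m + 4)
    (hq0 : ∀ t ∈ s, 0 ≤ q t) (hq : (fun t => (t - x) ^ k) =O[𝓝 x] q)
    (hh : h =O[𝓝 x] fun t => (t - x) ^ m) :
    (fun t => (t - x) ^ 2 • h t) =O[𝓝[s] x] fun t => √(q t) := by
  have hsq : (fun t => (t - x) ^ (m + 2)) =O[𝓝[s] x] fun t => √(q t) := by
    refine IsBigO.of_pow two_ne_zero ((((pow_sub_isBigO_pow_sub x hkm).trans hq).mono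
      nhdsWithin_le_nhds).congr' (.of_forall fun t => ?_) ?_)
    · simp only [Pi.pow_apply]
      ring
    · filter_upwards [self_mem_nhdsWithin] with t ht
      exact (Real.sq_sqrt (hq0 t ht)).symm
  refine (((isBigO_refl (fun t => (t - x) ^ 2) _).smul hh).mono nhdsWithin_le_nhds).trans ?_
  exact hsq.congr_left fun t => by rw [smul_eq_mul]; ring

theorem exists_prod_smul_isBigO_sqrt (hq : AnalyticOnNhd ℝ q (Icc a b))
    (hh : ContinuousOn h (Icc a b)) (hq0 : ∀ t ∈ Icc a b, 0 ≤ q t)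
    (hne : ∃ t ∈ Icc a b, q t ≠ 0)
    (hloc : ∀ x ∈ Icc a b, (fun t => (t - x) ^ 2 • h t) =O[𝓝[Icc a b] x] fun t => √(q t)) :
    ∃ S : Finset ℝ,
      (fun t => (∏ s ∈ S, (t - s) ^ 2) • h t) =O[𝓟 (Icc a b)] fun t => √(q t) := by
  have hfin := finite_zeros_of_analyticOnNhd_Icc hq hne
  refine ⟨hfin.toFinset, isBigO_principal_of_forall_nhdsWithin isCompact_Icc Subset.rfl
    fun x hx => ?_⟩
  by_cases hqx : q x = 0
  · have hxS : x ∈ hfin.toFinset := hfin.mem_toFinset.2 ⟨hx, hqx⟩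
    have hprod : (fun t => ∏ s ∈ hfin.toFinset.erase x, (t - s) ^ 2) =O[𝓝[Icc a b] x]
        fun _ => (1 : ℝ) :=
      ((Continuous.tendsto (by fun_prop) x).mono_left nhdsWithin_le_nhds).isBigO_one ℝ
    refine (hprod.smul (hloc x hx)).congr (fun t => ?_) fun t => one_smul ℝ _
    rw [smul_smul, Finset.prod_erase_mul _ _ hxS]
  · refine isBigO_nhdsWithin_of_ne_zero (ContinuousWithinAt.smul ?_ (hh x hx))
      (hq x hx).continuousAt.sqrt.continuousWithinAt
      (Real.sqrt_pos.2 ((hq0 x hx).lt_of_ne' hqx)).ne'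
    exact Continuous.continuousWithinAt (by fun_prop)

theorem sq_smul_isBigO_of_prod_smul {s : Set ℝ} {S : Finset ℝ} {g : ℝ → ℝ}
    (hS : (fun t => (∏ s ∈ S, (t - s) ^ 2) • h t) =O[𝓟 s] g) :
    (fun t => (t - x) ^ 2 • h t) =O[𝓝[s] x] g := by
  set G : ℝ → ℝ := fun t => ∏ s ∈ S.erase x, (t - s) ^ 2
  have hG : Continuous G := by fun_prop
  have hGx : G x ≠ 0 := Finset.prod_ne_zero_iff.2 fun s hs =>
    pow_ne_zero 2 (sub_ne_zero.2 (Finset.ne_of_mem_erase hs).symm)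
  have hprod : (fun t => (t - x) ^ 2) =O[𝓝 x] fun t => ∏ s ∈ S, (t - s) ^ 2 := by
    have hone : (fun _ => (1 : ℝ)) =O[𝓝 x] G := by
      rw [← nhdsWithin_univ]
      exact isBigO_nhdsWithin_of_ne_zero continuousWithinAt_const hG.continuousWithinAt hGx
    by_cases hxS : x ∈ S
    · exact ((isBigO_refl (fun t => (t - x) ^ 2) _).mul hone).congr (fun t => mul_one _)
        fun t => Finset.mul_prod_erase S (fun s => (t - s) ^ 2) hxS
    · simp only [G, Finset.erase_eq_of_notMem hxS] at hone
      exact ((Continuous.tendsto (by fun_prop) x).isBigO_one ℝ).trans hone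
  exact ((hprod.mono nhdsWithin_le_nhds).smul (isBigO_refl h _)).trans
    (hS.mono (le_principal_iff.2 self_mem_nhdsWithin))

theorem isBigO_leviMajorant (hq : AnalyticOnNhd ℝ q (Icc a b))
    (hh : ContinuousOn h (Icc a b)) (hq0 : ∀ t ∈ Icc a b, 0 ≤ q t)
    (hloc : ∀ x ∈ Icc a b, (fun t => (t - x) ^ 2 • h t) =O[𝓝[Icc a b] x] fun t => √(q t)) :
    h =O[𝓟 {t ∈ Icc a b | q t ≠ 0}] leviMajorant q := by
  set A := {t ∈ Icc a b | q t ≠ 0}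
  have hAI : A ⊆ Icc a b := sep_subset _ _
  refine isBigO_principal_of_forall_nhdsWithin isCompact_Icc hAI fun x hx => ?_
  have hA : ∀ᶠ t in 𝓝[A] x, 0 < q t :=
    eventually_mem_nhdsWithin.mono fun t ht => (hq0 t ht.1).lt_of_ne' ht.2
  by_cases hqx : q x = 0
  · have hmul : (fun t => (t - x) ^ 2 • h t) =O[𝓝[A] x]
        fun t => (t - x) ^ 2 • (deriv q t ^ 2 / (q t * √(q t))) := by
      have hsq := (((isBigO_sub_mul_deriv (hq x hx) hqx).pow 2).mono
        (nhdsWithin_le_nhds (s := A))).mul (isBigO_refl (fun t => (q t * √(q t))⁻¹) _)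
      refine ((hloc x hx).mono (nhdsWithin_mono x hAI)).trans (hsq.congr' ?_ ?_)
      · filter_upwards [hA] with t ht
        have hsqrt := Real.sq_sqrt ht.le
        field_simp
        exact hsqrt.symm
      · exact .of_forall fun t => by simp only [smul_eq_mul]; ring
    have hcancel := (isBigO_refl (fun t => ((t - x) ^ 2)⁻¹) (𝓝[A] x)).smul hmul
    have hne : ∀ᶠ t in 𝓝[A] x, (t - x) ^ 2 ≠ 0 := hA.mono fun t ht =>
      pow_ne_zero 2 (sub_ne_zero.2 fun htx => ht.ne' (htx ▸ hqx))
    refine (hcancel.congr' (hne.mono fun t ht => inv_smul_smul₀ ht _)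
      (hne.mono fun t ht => inv_smul_smul₀ ht _)).trans (IsBigO.of_norm_eventuallyLE ?_)
    filter_upwards [hA] with t ht
    have hpos : 0 ≤ deriv q t ^ 2 / (q t * √(q t)) := by positivity
    rw [Real.norm_of_nonneg hpos, leviMajorant]
    exact le_add_of_nonneg_left (Real.sqrt_nonneg _)
  · refine (isBigO_nhdsWithin_of_ne_zero ((hh x hx).mono hAI)
      (hq x hx).continuousAt.sqrt.continuousWithinAt
      (Real.sqrt_pos.2 ((hq0 x hx).lt_of_ne' hqx)).ne').trans (IsBigO.of_norm_eventuallyLE ?_)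
    filter_upwards [hA] with t ht
    rw [Real.norm_of_nonneg (Real.sqrt_nonneg _)]
    exact sqrt_le_leviMajorant ht.le

end LocalLevi

section Concentration

open Set Filter Topology Asymptotics

variable {F : Type*} [NormedAddCommGroup F] [NormedSpace ℝ F] {q : ℝ → ℝ} {h : ℝ → F}
  {a b x : ℝ}

theorem exists_Icc_at_distance {r : ℝ} (hx : x ∈ Icc a b) (hr : 0 < r) (hrab : r ≤ (b - a) / 2) :
    ∃ c, a ≤ c ∧ c + r / 2 ≤ b ∧ ∀ t ∈ Icc c (c + r / 2), r / 2 ≤ |t - x| ∧ |t - x| ≤ r := by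
  obtain ⟨hax, hxb⟩ := hx
  rcases le_total x ((a + b) / 2) with hmid | hmid
  · refine ⟨x + r / 2, by linarith, by linarith, fun t ht => ?_⟩
    rw [abs_of_nonneg (by linarith [ht.1])]
    constructor <;> linarith [ht.1, ht.2]
  · refine ⟨x - r, by linarith, by linarith, fun t ht => ?_⟩
    rw [abs_of_nonpos (by linarith [ht.2])]
    constructor <;> linarith [ht.1, ht.2]

theorem le_leviDensity {R K D y t : ℝ} (hR : 0 ≤ R) (hD : 0 < D) (hq0 : 0 ≤ q t)
    (hq : R ^ 2 * q t ≤ K) (hh : y ≤ D * ‖h t‖) :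
    √(R * y) / √(D * √(K + 8)) ≤
      leviDensity (fun s => R ^ 2 * q s) (fun s => R • h s) t := by
  have hpos : 0 < √(R ^ 2 * q t + 8) :=
    Real.sqrt_pos.2 (add_pos_of_nonneg_of_pos (mul_nonneg (sq_nonneg R) hq0) (by norm_num))
  have hle : √(R ^ 2 * q t + 8) ≤ √(K + 8) := Real.sqrt_le_sqrt (by linarith)
  rw [leviDensity, norm_smul, Real.norm_of_nonneg hR, ← Real.sqrt_div' _ (by positivity)]
  refine Real.sqrt_le_sqrt ?_
  calc R * y / (D * √(K + 8)) ≤ R * (D * ‖h t‖) / (D * √(K + 8)) := by gcongr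
    _ = R * ‖h t‖ / √(K + 8) := by rw [mul_left_comm, mul_div_mul_left _ _ hD.ne']
    _ ≤ R * ‖h t‖ / √(R ^ 2 * q t + 8) :=
        div_le_div_of_nonneg_left (mul_nonneg hR (norm_nonneg _)) hpos hle

theorem mul_le_integral_of_le_on_Icc {f : ℝ → ℝ} {c d B : ℝ} (hf : ContinuousOn f (Icc a b))
    (hf0 : ∀ t ∈ Icc a b, 0 ≤ f t) (hac : a ≤ c) (hcd : c ≤ d) (hdb : d ≤ b)
    (hB : ∀ t ∈ Icc c d, B ≤ f t) : (d - c) * B ≤ ∫ t in a..b, f t := by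
  have hab : a ≤ b := (hac.trans hcd).trans hdb
  have hnonneg : 0 ≤ᵐ[MeasureTheory.volume.restrict (Ioc a b)] f :=
    MeasureTheory.ae_restrict_of_forall_mem measurableSet_Ioc fun t ht =>
      hf0 t (Ioc_subset_Icc_self ht)
  calc (d - c) * B = ∫ _ in c..d, B := by rw [intervalIntegral.integral_const, smul_eq_mul]
    _ ≤ ∫ t in c..d, f t :=
        intervalIntegral.integral_mono_on hcd intervalIntegrable_const
          ((hf.mono (Icc_subset_Icc hac hdb)).intervalIntegrable_of_Icc hcd) hB
    _ ≤ ∫ t in a..b, f t :=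
        intervalIntegral.integral_mono_interval hac hcd hdb hnonneg
          (hf.intervalIntegrable_of_Icc hab)

theorem eventually_le_integral_leviDensity (hab : a < b) (hq : ContinuousOn q (Icc a b))
    (hq0 : ∀ t ∈ Icc a b, 0 ≤ q t) (hh : ContinuousOn h (Icc a b)) (hx : x ∈ Icc a b)
    {k m : ℕ} (hqk : q =O[𝓝 x] fun t => (t - x) ^ k)
    (hhm : (fun t => (t - x) ^ m) =O[𝓝 x] h) :
    ∃ c > 0, ∀ᶠ r in 𝓝[>] 0, ∀ R, 0 ≤ R → R ^ 2 * r ^ k ≤ 1 →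
      c * (r * √(R * r ^ m)) ≤
        ∫ t in a..b, leviDensity (fun s => R ^ 2 * q s) (fun s => R • h s) t := by
  obtain ⟨K, hK, hqK⟩ := hqk.exists_pos
  obtain ⟨D, hD, hhD⟩ := hhm.exists_pos
  obtain ⟨δ, hδ, hball⟩ := Metric.eventually_nhds_iff.1 (hqK.bound.and hhD.bound)
  refine ⟨(√(2 ^ m * D * √(K + 8)))⁻¹ / 2, by positivity, ?_⟩
  filter_upwards [Ioo_mem_nhdsGT (lt_min hδ (half_pos (sub_pos.2 hab)))]
    with r ⟨hr, hrlt⟩ R hR hRr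
  obtain ⟨c, hac, hcb, hc⟩ :=
    exists_Icc_at_distance hx hr (hrlt.le.trans (min_le_right _ _))
  have hsub : Icc c (c + r / 2) ⊆ Icc a b := Icc_subset_Icc hac hcb
  have hle : ∀ t ∈ Icc c (c + r / 2), √(R * r ^ m) / √(2 ^ m * D * √(K + 8)) ≤
      leviDensity (fun s => R ^ 2 * q s) (fun s => R • h s) t := by
    intro t ht
    obtain ⟨hrt, htr⟩ := hc t ht
    obtain ⟨hqt, hht⟩ := hball (y := t) (by
      rw [Real.dist_eq]; exact htr.trans_lt (hrlt.trans_le (min_le_left _ _)))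
    rw [norm_pow, Real.norm_eq_abs] at hht
    rw [Real.norm_of_nonneg (hq0 t (hsub ht)), norm_pow, Real.norm_eq_abs] at hqt
    refine le_leviDensity hR (by positivity) (hq0 t (hsub ht)) ?_ ?_
    · calc R ^ 2 * q t ≤ R ^ 2 * (K * r ^ k) := by gcongr; exact hqt.trans (by gcongr)
        _ = K * (R ^ 2 * r ^ k) := by ring
        _ ≤ K := mul_le_of_le_one_right hK.le hRr
    · calc r ^ m = 2 ^ m * (r / 2) ^ m := by rw [← mul_pow, mul_div_cancel₀ _ two_ne_zero]
        _ ≤ 2 ^ m * |t - x| ^ m := by gcongr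
        _ ≤ 2 ^ m * D * ‖h t‖ := by rw [mul_assoc]; gcongr
  have hcont : ContinuousOn (leviDensity (fun s => R ^ 2 * q s) (fun s => R • h s)) (Icc a b) :=
    continuousOn_leviDensity (hq.const_mul _) (fun t ht => mul_nonneg (sq_nonneg R) (hq0 t ht))
      (hh.const_smul R)
  calc (√(2 ^ m * D * √(K + 8)))⁻¹ / 2 * (r * √(R * r ^ m))
      = (c + r / 2 - c) * (√(R * r ^ m) / √(2 ^ m * D * √(K + 8))) := by ring
    _ ≤ _ := mul_le_integral_of_le_on_Icc hcont (fun t _ => leviDensity_nonneg _ _ t) hac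
        (by linarith) hcb hle

theorem isLittleO_log_one_add_pow_atTop (n : ℕ) :
    (fun z : ℝ => Real.log (1 + z ^ n)) =o[atTop] id := by
  refine IsBigO.trans_isLittleO (g := Real.log) (IsBigO.of_bound (n + 1) ?_)
    Real.isLittleO_log_id_atTop
  filter_upwards [eventually_ge_atTop 2] with z hz
  have hpow : 1 ≤ z ^ n := one_le_pow₀ (by linarith)
  rw [Real.norm_of_nonneg (Real.log_nonneg (by linarith)),
    Real.norm_of_nonneg (Real.log_nonneg (by linarith))]
  calc Real.log (1 + z ^ n) ≤ Real.log (z ^ (n + 1)) :=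
        Real.log_le_log (by linarith) (by rw [pow_succ]; nlinarith)
    _ = (n + 1) * Real.log z := by rw [Real.log_pow]; push_cast; rfl

theorem order_le_of_integral_leviDensity_le (hab : a < b) (hq : ContinuousOn q (Icc a b))
    (hq0 : ∀ t ∈ Icc a b, 0 ≤ q t) (hh : ContinuousOn h (Icc a b)) (hx : x ∈ Icc a b)
    {k m : ℕ} (hqk : q =O[𝓝 x] fun t => (t - x) ^ k)
    (hhm : (fun t => (t - x) ^ m) =O[𝓝 x] h) {C : ℝ}
    (hint : ∀ R, 1 ≤ R → ∫ t in a..b, leviDensity (fun s => R ^ 2 * q s) (fun s => R • h s) t ≤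
      C * Real.log (1 + R)) :
    k ≤ 2 * m + 4 := by
  by_contra! hlt
  obtain ⟨c, hc, hr⟩ := eventually_le_integral_leviDensity hab hq hq0 hh hx hqk hhm
  have hsubst : Tendsto (fun z : ℝ => (z ^ 4)⁻¹) atTop (𝓝[>] 0) :=
    tendsto_inv_atTop_nhdsGT_zero.comp (tendsto_pow_atTop four_ne_zero)
  have hlin : ∀ᶠ z : ℝ in atTop, c * z ≤ C * Real.log (1 + z ^ (2 * k)) := by
    filter_upwards [hsubst.eventually hr, eventually_ge_atTop 1] with z hz hz1
    have hz0 : z ≠ 0 := by linarith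
    have hscale : (z ^ 4)⁻¹ * √(z ^ (2 * k) * (z ^ 4)⁻¹ ^ m) = z ^ (k - (2 * m + 4)) := by
      obtain ⟨d, rfl⟩ := Nat.exists_eq_add_of_le hlt.le
      have hsq : z ^ (2 * (2 * m + 4 + d)) * (z ^ 4)⁻¹ ^ m = (z ^ (d + 4)) ^ 2 := by
        simp only [inv_pow]
        field_simp
        ring
      rw [hsq, Real.sqrt_sq (by positivity), Nat.add_sub_cancel_left, pow_add]
      field_simp
    calc c * z ≤ c * z ^ (k - (2 * m + 4)) := by
          gcongr; exact le_self_pow₀ hz1 (by omega)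
      _ ≤ _ := hscale ▸ hz (z ^ (2 * k)) (by positivity) (le_of_eq (by
          simp only [inv_pow]; field_simp; ring))
      _ ≤ C * Real.log (1 + z ^ (2 * k)) := hint _ (one_le_pow₀ hz1)
  have hbig : (id : ℝ → ℝ) =O[atTop] fun z => Real.log (1 + z ^ (2 * k)) := by
    refine IsBigO.of_bound (|C| / c) ?_
    filter_upwards [hlin, eventually_ge_atTop 0] with z hz hz0
    rw [id, Real.norm_of_nonneg hz0, div_mul_eq_mul_div, le_div_iff₀' hc]
    refine hz.trans ((le_abs_self _).trans_eq ?_)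
    rw [abs_mul, Real.norm_eq_abs]
  exact (isLittleO_log_one_add_pow_atTop (2 * k)).not_isBigO
    ((eventually_gt_atTop 0).mono fun z hz =>
      (Real.log_pos (lt_add_of_pos_right 1 (pow_pos hz _))).ne').frequently hbig

theorem sq_smul_isBigO_sqrt_of_integral_leviDensity_le (hab : a < b)
    (hq : AnalyticOnNhd ℝ q (Icc a b)) (hq0 : ∀ t ∈ Icc a b, 0 ≤ q t)
    (hne : ∃ t ∈ Icc a b, q t ≠ 0) (hh : AnalyticOnNhd ℝ h (Icc a b)) {C : ℝ}
    (hint : ∀ R, 1 ≤ R → ∫ t in a..b, leviDensity (fun s => R ^ 2 * q s) (fun s => R • h s) t ≤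
      C * Real.log (1 + R)) (hx : x ∈ Icc a b) :
    (fun t => (t - x) ^ 2 • h t) =O[𝓝[Icc a b] x] fun t => √(q t) := by
  by_cases hhtop : analyticOrderAt h x = ⊤
  · refine IsBigO.mono ((isBigO_zero _ _).congr' ?_ EventuallyEq.rfl) nhdsWithin_le_nhds
    exact (analyticOrderAt_eq_top.1 hhtop).mono fun t ht => by simp [ht]
  · have hqtop : analyticOrderAt q x ≠ ⊤ := by
      obtain ⟨t, ht, hqt⟩ := hne
      exact hq.analyticOrderAt_ne_top_of_isPreconnected isPreconnected_Icc ht hx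
        (by simp [(hq t ht).analyticOrderAt_eq_zero.2 hqt])
    have hqk := isTheta_pow_analyticOrderNatAt (hq x hx) hqtop
    have hhm := isTheta_pow_analyticOrderNatAt (hh x hx) hhtop
    exact sq_smul_isBigO_sqrt_of_order_le
      (order_le_of_integral_leviDensity_le hab hq.continuousOn hq0 hh.continuousOn hx hqk.isBigO
        hhm.symm.isBigO hint) hq0 hqk.symm.isBigO hhm.isBigO

end Concentration

namespace ThirdOrderOperator

section Symbols

open Finset

variable {n : ℕ}

/-- The multi-indices of length `k`. -/
abbrev multiIdx (n k : ℕ) : Finset (Fin n → ℕ) := piAntidiag univ k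

theorem monom_zero (ξ : EuclideanSpace ℝ (Fin n)) : monom ξ 0 = 1 := by
  simp [monom]

theorem monom_add (ξ : EuclideanSpace ℝ (Fin n)) (α β : Fin n → ℕ) :
    monom ξ (α + β) = monom ξ α * monom ξ β := by
  simp [monom, pow_add, prod_mul_distrib]

theorem monom_single (ξ : EuclideanSpace ℝ (Fin n)) (i : Fin n) :
    monom ξ (Pi.single i 1) = ξ i := by
  rw [monom, prod_eq_single_of_mem i (mem_univ i) fun j _ hj => by
    rw [Pi.single_eq_of_ne hj, pow_zero], Pi.single_eq_same, pow_one]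

theorem exists_eq_single_add_of_mem_multiIdx {k : ℕ} {α : Fin n → ℕ}
    (hα : α ∈ multiIdx n (k + 1)) : ∃ i, ∃ β ∈ multiIdx n k, α = Pi.single i 1 + β := by
  have hsum : ∑ i, α i = k + 1 := (mem_piAntidiag.1 hα).1
  obtain ⟨i, -, hi⟩ := exists_ne_zero_of_sum_ne_zero (hsum.trans_ne k.succ_ne_zero)
  have hle : Pi.single i 1 ≤ α := by
    intro j
    rcases eq_or_ne j i with rfl | hj
    · rw [Pi.single_eq_same]
      exact Nat.one_le_iff_ne_zero.2 hi
    · rw [Pi.single_eq_of_ne hj]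
      exact Nat.zero_le _
  refine ⟨i, α - Pi.single i 1, mem_piAntidiag.2 ⟨?_, fun _ _ => mem_univ _⟩,
    (add_tsub_cancel_of_le hle).symm⟩
  have hsplit : ∑ j, α j = ∑ j, (Pi.single i 1 : Fin n → ℕ) j +
      ∑ j, (α - Pi.single i 1 : Fin n → ℕ) j := by
    rw [← sum_add_distrib]
    exact sum_congr rfl fun j _ => (congrFun (add_tsub_cancel_of_le hle) j).symm
  rw [hsum, Fintype.sum_pi_single', add_comm] at hsplit
  exact (add_left_cancel hsplit).symm

theorem exists_linearMap_monom {α : Fin n → ℕ} (hα : α ∈ multiIdx n 1) :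
    ∃ ℓ : EuclideanSpace ℝ (Fin n) →ₗ[ℝ] ℝ, ∀ ξ, monom ξ α = ℓ ξ := by
  obtain ⟨i, β, hβ, rfl⟩ := exists_eq_single_add_of_mem_multiIdx hα
  rw [multiIdx, piAntidiag_zero, mem_singleton] at hβ
  exact ⟨(EuclideanSpace.proj i : EuclideanSpace ℝ (Fin n) →L[ℝ] ℝ), fun ξ => by
    rw [hβ, add_zero, monom_single]; rfl⟩

theorem exists_quadraticForm_monom {α : Fin n → ℕ} (hα : α ∈ multiIdx n 2) :
    ∃ Q : QuadraticForm ℝ (EuclideanSpace ℝ (Fin n)), ∀ ξ, monom ξ α = Q ξ := by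
  obtain ⟨i, β, hβ, rfl⟩ := exists_eq_single_add_of_mem_multiIdx hα
  obtain ⟨ℓ, hℓ⟩ := exists_linearMap_monom hβ
  exact ⟨QuadraticMap.linMulLin
    (EuclideanSpace.proj i : EuclideanSpace ℝ (Fin n) →L[ℝ] ℝ).toLinearMap ℓ, fun ξ => by
      rw [monom_add, monom_single, hℓ]; rfl⟩

theorem exists_linearMap_sum_monom {F : Type*} [AddCommGroup F] [Module ℝ F]
    (c : (Fin n → ℕ) → F) : ∃ ℓ : EuclideanSpace ℝ (Fin n) →ₗ[ℝ] F,
      ∀ ξ, ∑ α ∈ multiIdx n 1, monom ξ α • c α = ℓ ξ := by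
  choose! ℓ hℓ using fun α (hα : α ∈ multiIdx n 1) => exists_linearMap_monom hα
  refine ⟨∑ α ∈ multiIdx n 1, (ℓ α).smulRight (c α), fun ξ => ?_⟩
  rw [LinearMap.sum_apply]
  exact sum_congr rfl fun α hα => by rw [hℓ α hα, LinearMap.smulRight_apply]

theorem exists_quadraticForm_sum_monom (c : (Fin n → ℕ) → ℝ) :
    ∃ Q : QuadraticForm ℝ (EuclideanSpace ℝ (Fin n)),
      ∀ ξ, ∑ α ∈ multiIdx n 2, c α * monom ξ α = Q ξ := by
  choose! Q hQ using fun α (hα : α ∈ multiIdx n 2) => exists_quadraticForm_monom hα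
  refine ⟨∑ α ∈ multiIdx n 2, c α • Q α, fun ξ => ?_⟩
  rw [_root_.sum_apply]
  exact sum_congr rfl fun α hα => by rw [hQ α hα]; rfl

variable (P : ThirdOrderOperator n)

/-- The coefficient of `τ²` in `L`. -/
noncomputable def coeffA (t : ℝ) (ξ : EuclideanSpace ℝ (Fin n)) : ℝ :=
  ∑ α ∈ multiIdx n 1, P.lead 2 α t * monom ξ α

/-- The coefficient of `τ` in `L`. -/
noncomputable def coeffB (t : ℝ) (ξ : EuclideanSpace ℝ (Fin n)) : ℝ :=
  ∑ α ∈ multiIdx n 2, P.lead 1 α t * monom ξ α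

/-- The coefficient of `τ⁰` in `L`. -/
noncomputable def coeffD (t : ℝ) (ξ : EuclideanSpace ℝ (Fin n)) : ℝ :=
  ∑ α ∈ multiIdx n 3, P.lead 0 α t * monom ξ α

/-- The discriminant of the monic polynomial `∂_τ L / 3`; it is a quadratic form in `ξ` and equals
`Δ` as soon as it is nonnegative. -/
noncomputable def disc (t : ℝ) (ξ : EuclideanSpace ℝ (Fin n)) : ℝ :=
  4 / 9 * (P.coeffA t ξ ^ 2 - 3 * P.coeffB t ξ)

/-- The coefficient of `τ` in `Ň`. -/
noncomputable def slope (t : ℝ) : ℂ := P.lower 1 0 t - deriv (P.lower 2 0) t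

/-- The coefficients of the linear form `mid`. -/
noncomputable def midCoeff (α : Fin n → ℕ) (t : ℝ) : ℂ :=
  P.lower 0 α t - 1 / 2 * deriv (P.lower 1 α) t +
    1 / 6 * ((iteratedDeriv 2 (P.lead 2 α) t : ℝ) : ℂ) - 1 / 3 * P.slope t * (P.lead 2 α t : ℂ)

/-- The value of `Ň` at `-A / 3`, where `A` is the coefficient of `τ²` in `L`: this is the common
midpoint of `σ₁, σ₂` and of `μ₁, μ₂`. It is a linear form in `ξ`. -/
noncomputable def mid (t : ℝ) (ξ : EuclideanSpace ℝ (Fin n)) : ℂ :=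
  ∑ α ∈ multiIdx n 1, P.midCoeff α t * (monom ξ α : ℂ)

theorem symL_eq (t τ : ℝ) (ξ : EuclideanSpace ℝ (Fin n)) :
    P.symL t τ ξ = τ ^ 3 + P.coeffA t ξ * τ ^ 2 + P.coeffB t ξ * τ + P.coeffD t ξ := by
  simp only [symL, sum_range_succ, sum_range_zero, coeffA, coeffB, coeffD, sum_mul, Nat.reduceSub,
    Nat.sub_zero, zero_add, pow_zero, mul_one, pow_one, mul_right_comm _ (monom _ _)]
  ring

theorem symM_eq (t τ : ℝ) (ξ : EuclideanSpace ℝ (Fin n)) :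
    P.symM t τ ξ = P.lower 2 0 t * (τ : ℂ) ^ 2 +
      (∑ α ∈ multiIdx n 1, P.lower 1 α t * (monom ξ α : ℂ)) * τ +
      ∑ α ∈ multiIdx n 2, P.lower 0 α t * (monom ξ α : ℂ) := by
  simp only [symM, sum_range_succ, sum_range_zero, sum_mul, Nat.sub_self, Nat.reduceSub,
    Nat.sub_zero, zero_add, pow_zero, mul_one, pow_one, piAntidiag_zero, sum_singleton,
    monom_zero, Complex.ofReal_one, mul_right_comm _ (monom _ _ : ℂ)]
  ring

theorem symN_eq (t τ : ℝ) (ξ : EuclideanSpace ℝ (Fin n)) :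
    P.symN t τ ξ = P.lower 1 0 t * (τ : ℂ) +
      ∑ α ∈ multiIdx n 1, P.lower 0 α t * (monom ξ α : ℂ) := by
  simp only [symN, sum_range_succ, sum_range_zero, Nat.sub_self, Nat.sub_zero, zero_add, pow_zero,
    mul_one, pow_one, piAntidiag_zero, sum_singleton, monom_zero, Complex.ofReal_one]
  ring

theorem deriv_symM (t τ : ℝ) (ξ : EuclideanSpace ℝ (Fin n)) :
    deriv (fun z : ℝ => P.symM t z ξ) τ = 2 * P.lower 2 0 t * (τ : ℂ) +
      ∑ α ∈ multiIdx n 1, P.lower 1 α t * (monom ξ α : ℂ) := by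
  simp only [symM_eq]
  have hid : HasDerivAt (fun z : ℝ => (z : ℂ)) 1 τ := Complex.ofRealCLM.hasDerivAt
  refine ((((hid.fun_pow 2).const_mul _).add (hid.const_mul _)).add_const _).deriv.trans ?_
  push_cast
  ring

theorem hasDerivAt_symL (t τ : ℝ) (ξ : EuclideanSpace ℝ (Fin n)) :
    HasDerivAt (fun z : ℝ => P.symL t z ξ)
      (3 * τ ^ 2 + 2 * P.coeffA t ξ * τ + P.coeffB t ξ) τ := by
  simp only [symL_eq]
  refine ((((hasDerivAt_pow 3 τ).add ((hasDerivAt_pow 2 τ).const_mul _)).add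
    ((hasDerivAt_id τ).const_mul _)).add_const _).congr_deriv ?_
  norm_num
  ring

theorem dL_eq (t τ : ℝ) (ξ : EuclideanSpace ℝ (Fin n)) :
    P.dL t τ ξ = 3 * τ ^ 2 + 2 * P.coeffA t ξ * τ + P.coeffB t ξ :=
  (P.hasDerivAt_symL t τ ξ).deriv

theorem iteratedDeriv_symL (t τ : ℝ) (ξ : EuclideanSpace ℝ (Fin n)) :
    iteratedDeriv 2 (fun z : ℝ => P.symL t z ξ) τ = 6 * τ + 2 * P.coeffA t ξ := by
  rw [iteratedDeriv_succ, iteratedDeriv_one, funext fun z => (P.hasDerivAt_symL t z ξ).deriv]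
  refine ((((hasDerivAt_pow 2 τ).const_mul 3).add
    ((hasDerivAt_id τ).const_mul _)).add_const _).deriv.trans ?_
  norm_num
  ring

theorem dLaux_eq (t τ : ℝ) (ξ : EuclideanSpace ℝ (Fin n)) :
    P.dLaux t τ ξ = 3 * τ ^ 2 + 2 * P.coeffA t ξ * τ + (P.coeffB t ξ - 6) := by
  simp only [dLaux, symLaux, iteratedDeriv_symL]
  refine ((P.hasDerivAt_symL t τ ξ).sub
    (((hasDerivAt_id τ).const_mul 6).add_const _)).deriv.trans ?_
  ring

theorem exists_linearMap_mid (t : ℝ) :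
    ∃ ℓ : EuclideanSpace ℝ (Fin n) →ₗ[ℝ] ℂ, ∀ ξ, P.mid t ξ = ℓ ξ := by
  obtain ⟨ℓ, hℓ⟩ := exists_linearMap_sum_monom fun α => P.midCoeff α t
  refine ⟨ℓ, fun ξ => (hℓ ξ).symm ▸ sum_congr rfl fun α _ => ?_⟩
  rw [Complex.real_smul, mul_comm]

theorem exists_quadraticForm_disc (t : ℝ) :
    ∃ Q : QuadraticForm ℝ (EuclideanSpace ℝ (Fin n)), ∀ ξ, P.disc t ξ = Q ξ := by
  obtain ⟨A, hA⟩ := exists_linearMap_sum_monom fun α => P.lead 2 α t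
  obtain ⟨B, hB⟩ := exists_quadraticForm_sum_monom fun α => P.lead 1 α t
  refine ⟨(4 / 9 : ℝ) • (QuadraticMap.linMulLin A A - (3 : ℝ) • B), fun ξ => ?_⟩
  have hcoeffA : P.coeffA t ξ = A ξ := by
    rw [← hA, coeffA]
    exact sum_congr rfl fun α _ => mul_comm _ _
  rw [disc, hcoeffA, coeffB, hB, sq]
  rfl

theorem disc_smul (t r : ℝ) (ξ : EuclideanSpace ℝ (Fin n)) :
    P.disc t (r • ξ) = r ^ 2 * P.disc t ξ := by
  obtain ⟨Q, hQ⟩ := P.exists_quadraticForm_disc t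
  rw [hQ, hQ, QuadraticMap.map_smul, smul_eq_mul, sq]

theorem mid_smul (t r : ℝ) (ξ : EuclideanSpace ℝ (Fin n)) :
    P.mid t (r • ξ) = r • P.mid t ξ := by
  obtain ⟨ℓ, hℓ⟩ := P.exists_linearMap_mid t
  rw [hℓ, hℓ, map_smul]

end Symbols

section Analyticity

open Set

variable {n : ℕ} {P : ThirdOrderOperator n} {T : ℝ}

theorem AnalyticCoefficients.lead (h : P.AnalyticCoefficients T) {j k : ℕ} {α : Fin n → ℕ}
    (hα : α ∈ multiIdx n k) (hj : j < 3 := by norm_num) (hjk : j + k = 3 := by norm_num) :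
    AnalyticOnNhd ℝ (P.lead j α) (Icc 0 T) :=
  h.1 j α hj (by rw [(Finset.mem_piAntidiag.1 hα).1, hjk])

theorem AnalyticCoefficients.lower (h : P.AnalyticCoefficients T) {j k : ℕ} {α : Fin n → ℕ}
    (hα : α ∈ multiIdx n k) (hjk : j + k ≤ 2 := by norm_num) :
    AnalyticOnNhd ℝ (P.lower j α) (Icc 0 T) :=
  h.2 j α (by rwa [(Finset.mem_piAntidiag.1 hα).1])

theorem zero_mem_multiIdx : (0 : Fin n → ℕ) ∈ multiIdx n 0 := by
  rw [multiIdx, Finset.piAntidiag_zero, Finset.mem_singleton]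

theorem AnalyticCoefficients.slope (h : P.AnalyticCoefficients T) :
    AnalyticOnNhd ℝ P.slope (Icc 0 T) :=
  (h.lower zero_mem_multiIdx).sub (h.lower zero_mem_multiIdx).deriv

theorem AnalyticCoefficients.midCoeff (h : P.AnalyticCoefficients T) {α : Fin n → ℕ}
    (hα : α ∈ multiIdx n 1) : AnalyticOnNhd ℝ (P.midCoeff α) (Icc 0 T) := by
  have hlead : AnalyticOnNhd ℝ (P.lead 2 α) (Icc 0 T) := h.lead hα
  have hofReal {f : ℝ → ℝ} (hf : AnalyticOnNhd ℝ f (Icc 0 T)) :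
      AnalyticOnNhd ℝ (fun t => (f t : ℂ)) (Icc 0 T) := fun t ht =>
    (Complex.ofRealCLM.analyticAt _).comp (hf t ht)
  have hderiv : AnalyticOnNhd ℝ (iteratedDeriv 2 (P.lead 2 α)) (Icc 0 T) := by
    rw [iteratedDeriv_succ, iteratedDeriv_one]
    exact hlead.deriv.deriv
  exact (((h.lower hα).sub (analyticOnNhd_const.mul (h.lower hα).deriv)).add
    (analyticOnNhd_const.mul (hofReal hderiv))).sub
      ((analyticOnNhd_const.mul h.slope).mul (hofReal hlead))

theorem AnalyticCoefficients.mid (h : P.AnalyticCoefficients T) (ξ : EuclideanSpace ℝ (Fin n)) :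
    AnalyticOnNhd ℝ (fun t => P.mid t ξ) (Icc 0 T) :=
  Finset.analyticOnNhd_fun_sum _ fun _ hα => (h.midCoeff hα).mul analyticOnNhd_const

theorem AnalyticCoefficients.disc (h : P.AnalyticCoefficients T) (ξ : EuclideanSpace ℝ (Fin n)) :
    AnalyticOnNhd ℝ (fun t => P.disc t ξ) (Icc 0 T) :=
  have hA : AnalyticOnNhd ℝ (fun t => P.coeffA t ξ) (Icc 0 T) :=
    Finset.analyticOnNhd_fun_sum _ fun _ hα => (h.lead hα).mul analyticOnNhd_const
  have hB : AnalyticOnNhd ℝ (fun t => P.coeffB t ξ) (Icc 0 T) :=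
    Finset.analyticOnNhd_fun_sum _ fun _ hα => (h.lead hα).mul analyticOnNhd_const
  analyticOnNhd_const.mul ((hA.pow 2).sub (analyticOnNhd_const.mul hB))

theorem AnalyticCoefficients.iteratedDeriv_coeffA (h : P.AnalyticCoefficients T) {t : ℝ}
    (ht : t ∈ Icc 0 T) (ξ : EuclideanSpace ℝ (Fin n)) :
    iteratedDeriv 2 (fun s => P.coeffA s ξ) t =
      ∑ α ∈ multiIdx n 1, iteratedDeriv 2 (P.lead 2 α) t * monom ξ α := by
  have hlead {α : Fin n → ℕ} (hα : α ∈ multiIdx n 1) : ContDiffAt ℝ 2 (P.lead 2 α) t :=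
    ((h.lead hα) t ht).contDiffAt
  unfold coeffA
  rw [iteratedDeriv_fun_sum fun α hα => (hlead hα).mul contDiffAt_const]
  exact Finset.sum_congr rfl fun _ _ => iteratedDeriv_mul_const_field _ _

theorem AnalyticCoefficients.deriv_deriv_symM (h : P.AnalyticCoefficients T) {t : ℝ}
    (ht : t ∈ Icc 0 T) (τ : ℝ) (ξ : EuclideanSpace ℝ (Fin n)) :
    deriv (fun s : ℝ => deriv (fun z : ℝ => P.symM s z ξ) τ) t =
      2 * deriv (P.lower 2 0) t * (τ : ℂ) +
        ∑ α ∈ multiIdx n 1, deriv (P.lower 1 α) t * (monom ξ α : ℂ) := by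
  simp only [deriv_symM]
  refine HasDerivAt.deriv (HasDerivAt.add ?_ (HasDerivAt.fun_sum fun α hα => ?_))
  · exact (((h.lower zero_mem_multiIdx) t ht).differentiableAt.hasDerivAt.const_mul 2).mul_const _
  · exact ((h.lower hα) t ht).differentiableAt.hasDerivAt.mul_const _

theorem AnalyticCoefficients.symNcheck_eq (h : P.AnalyticCoefficients T) {t : ℝ}
    (ht : t ∈ Icc 0 T) (τ : ℝ) (ξ : EuclideanSpace ℝ (Fin n)) :
    P.symNcheck t τ ξ = P.mid t ξ + P.slope t * (τ + P.coeffA t ξ / 3 : ℝ) := by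
  rw [symNcheck, h.deriv_deriv_symM ht, symN_eq]
  simp only [iteratedDeriv_symL]
  rw [iteratedDeriv_const_add two_pos, iteratedDeriv_const_mul_field,
    h.iteratedDeriv_coeffA ht, ThirdOrderOperator.mid]
  simp only [ThirdOrderOperator.midCoeff, coeffA, ThirdOrderOperator.slope]
  push_cast
  simp only [sub_mul, add_mul, Finset.sum_sub_distrib, Finset.sum_add_distrib, mul_assoc,
    ← Finset.mul_sum]
  ring

end Analyticity

section Roots

open Set

variable {n : ℕ} {P : ThirdOrderOperator n} {T t : ℝ} {ξ : EuclideanSpace ℝ (Fin n)}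

theorem sInf_sSup_quadratic_roots {f : ℝ → ℝ} {b c : ℝ}
    (hf : ∀ x, f x = 3 * x ^ 2 + 2 * b * x + c) (h : 0 ≤ 4 / 9 * (b ^ 2 - 3 * c)) :
    sInf {y | f y = 0} = -b / 3 - √(4 / 9 * (b ^ 2 - 3 * c)) / 2 ∧
      sSup {y | f y = 0} = -b / 3 + √(4 / 9 * (b ^ 2 - 3 * c)) / 2 := by
  have hroots := quadratic_roots hf (by linarith)
  have hsqrt : √(4 / 9 * (b ^ 2 - 3 * c)) = 2 / 3 * √(b ^ 2 - 3 * c) := by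
    rw [Real.sqrt_mul (by norm_num), show (4 / 9 : ℝ) = (2 / 3) ^ 2 by norm_num,
      Real.sqrt_sq (by norm_num)]
  have h1 := (hroots 1).1
  have h2 := (hroots (-1)).1
  have hsub := (hroots 0).2
  rw [hf] at h1 h2
  rw [hsqrt]
  constructor <;> linarith

theorem σ₁_eq (h : 0 ≤ P.disc t ξ) : P.σ₁ t ξ = -P.coeffA t ξ / 3 - √(P.disc t ξ) / 2 :=
  (sInf_sSup_quadratic_roots (fun τ => P.dL_eq t τ ξ) h).1

theorem σ₂_eq (h : 0 ≤ P.disc t ξ) : P.σ₂ t ξ = -P.coeffA t ξ / 3 + √(P.disc t ξ) / 2 :=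
  (sInf_sSup_quadratic_roots (fun τ => P.dL_eq t τ ξ) h).2

theorem disc_add_eight :
    P.disc t ξ + 8 = 4 / 9 * (P.coeffA t ξ ^ 2 - 3 * (P.coeffB t ξ - 6)) := by
  rw [disc]
  ring

theorem μ₁_eq (h : 0 ≤ P.disc t ξ + 8) :
    P.μ₁ t ξ = -P.coeffA t ξ / 3 - √(P.disc t ξ + 8) / 2 := by
  rw [disc_add_eight] at h ⊢
  exact (sInf_sSup_quadratic_roots (fun τ => P.dLaux_eq t τ ξ) h).1

theorem μ₂_eq (h : 0 ≤ P.disc t ξ + 8) :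
    P.μ₂ t ξ = -P.coeffA t ξ / 3 + √(P.disc t ξ + 8) / 2 := by
  rw [disc_add_eight] at h ⊢
  exact (sInf_sSup_quadratic_roots (fun τ => P.dLaux_eq t τ ξ) h).2

theorem Δ_eq_disc (h : 0 ≤ P.disc t ξ) : P.Δ t ξ = P.disc t ξ := by
  rw [Δ, σ₁_eq h, σ₂_eq h]
  linear_combination Real.sq_sqrt h

theorem abs_σ₂_sub_σ₁ (h : 0 ≤ P.disc t ξ) : |P.σ₂ t ξ - P.σ₁ t ξ| = √(P.disc t ξ) := by
  rw [σ₁_eq h, σ₂_eq h, show ∀ x y : ℝ, x + y / 2 - (x - y / 2) = y by intros; ring,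
    abs_of_nonneg (Real.sqrt_nonneg _)]

theorem abs_μ₂_sub_μ₁ (h : 0 ≤ P.disc t ξ + 8) :
    |P.μ₂ t ξ - P.μ₁ t ξ| = √(P.disc t ξ + 8) := by
  rw [μ₁_eq h, μ₂_eq h, show ∀ x y : ℝ, x + y / 2 - (x - y / 2) = y by intros; ring,
    abs_of_nonneg (Real.sqrt_nonneg _)]

/-- `∂_τ L(t, ·, ξ)` has a real root for all `t ∈ [0, T]` and all `ξ`; being quadratic, it then has
two real roots. By Rolle's theorem this is weaker than weak hyperbolicity. -/
def HasRealCriticalPoints (P : ThirdOrderOperator n) (T : ℝ) : Prop :=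
  ∀ t ∈ Icc 0 T, ∀ ξ : EuclideanSpace ℝ (Fin n), ∃ τ : ℝ, P.dL t τ ξ = 0

theorem WeaklyHyperbolic.hasRealCriticalPoints (h : P.WeaklyHyperbolic T) :
    P.HasRealCriticalPoints T := fun t ht ξ =>
  ⟨P.σ₁ t ξ, by rw [(h.roots ht ξ).1, sub_self, mul_zero, zero_mul]⟩

theorem HasRealCriticalPoints.disc_nonneg (h : P.HasRealCriticalPoints T) (ht : t ∈ Icc 0 T)
    (ξ : EuclideanSpace ℝ (Fin n)) : 0 ≤ P.disc t ξ := by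
  obtain ⟨τ, hτ⟩ := h t ht ξ
  rw [dL_eq] at hτ
  have hsq : P.disc t ξ = 4 / 9 * (3 * τ + P.coeffA t ξ) ^ 2 := by
    rw [disc]
    linear_combination -(4 / 3) * hτ
  rw [hsq]
  positivity

end Roots

section Reduction

open Set Filter Asymptotics

theorem isBigO_principal_iff_exists_pos {X E : Type*} [SeminormedAddCommGroup E] {s : Set X}
    {f : X → E} {g : X → ℝ} (hg : ∀ x ∈ s, 0 ≤ g x) :
    f =O[𝓟 s] g ↔ ∃ C, 0 < C ∧ ∀ x ∈ s, ‖f x‖ ≤ C * g x := by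
  simp only [isBigO_iff', gt_iff_lt, eventually_principal]
  refine exists_congr fun C => and_congr_right fun _ => forall₂_congr fun x hx => ?_
  rw [Real.norm_of_nonneg (hg x hx)]

variable {n : ℕ} {P : ThirdOrderOperator n} {T t : ℝ} {ξ : EuclideanSpace ℝ (Fin n)}

theorem AnalyticCoefficients.symNcheck_σ₁ (h : P.AnalyticCoefficients T) (ht : t ∈ Icc 0 T)
    (h0 : 0 ≤ P.disc t ξ) :
    P.symNcheck t (P.σ₁ t ξ) ξ = P.mid t ξ - P.slope t * (√(P.disc t ξ) / 2 : ℝ) := by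
  rw [h.symNcheck_eq ht, σ₁_eq h0]
  push_cast
  ring

theorem AnalyticCoefficients.symNcheck_σ₂ (h : P.AnalyticCoefficients T) (ht : t ∈ Icc 0 T)
    (h0 : 0 ≤ P.disc t ξ) :
    P.symNcheck t (P.σ₂ t ξ) ξ = P.mid t ξ + P.slope t * (√(P.disc t ξ) / 2 : ℝ) := by
  rw [h.symNcheck_eq ht, σ₂_eq h0]
  push_cast
  ring

theorem AnalyticCoefficients.symNcheck_μ₁ (h : P.AnalyticCoefficients T) (ht : t ∈ Icc 0 T)
    (h0 : 0 ≤ P.disc t ξ + 8) :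
    P.symNcheck t (P.μ₁ t ξ) ξ = P.mid t ξ - P.slope t * (√(P.disc t ξ + 8) / 2 : ℝ) := by
  rw [h.symNcheck_eq ht, μ₁_eq h0]
  push_cast
  ring

theorem AnalyticCoefficients.symNcheck_μ₂ (h : P.AnalyticCoefficients T) (ht : t ∈ Icc 0 T)
    (h0 : 0 ≤ P.disc t ξ + 8) :
    P.symNcheck t (P.μ₂ t ξ) ξ = P.mid t ξ + P.slope t * (√(P.disc t ξ + 8) / 2 : ℝ) := by
  rw [h.symNcheck_eq ht, μ₂_eq h0]
  push_cast
  ring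

theorem leviMajorant_disc (hT : 0 < T) (h : P.AnalyticCoefficients T)
    (hc : P.HasRealCriticalPoints T) (ht : t ∈ Icc 0 T) (ξ : EuclideanSpace ℝ (Fin n)) :
    leviMajorant (fun s => P.disc s ξ) t = √(P.Δ t ξ) +
      derivWithin (fun s => P.Δ s ξ) (Icc 0 T) t ^ 2 / P.Δ t ξ ^ (3 / 2 : ℝ) := by
  have hderiv : derivWithin (fun s => P.Δ s ξ) (Icc 0 T) t = deriv (fun s => P.disc s ξ) t := by
    rw [derivWithin_congr (fun s hs => Δ_eq_disc (hc.disc_nonneg hs ξ))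
      (Δ_eq_disc (hc.disc_nonneg ht ξ))]
    exact (h.disc ξ t ht).differentiableAt.derivWithin (uniqueDiffOn_Icc hT t ht)
  have hpow : P.disc t ξ ^ (3 / 2 : ℝ) = P.disc t ξ * √(P.disc t ξ) := by
    rw [Real.sqrt_eq_rpow, ← Real.rpow_one_add' (hc.disc_nonneg ht ξ) (by norm_num)]
    norm_num
  rw [hderiv, Δ_eq_disc (hc.disc_nonneg ht ξ), hpow, leviMajorant]

theorem isBigO_mul_sqrt_disc {c : ℝ → ℂ} (hc : ContinuousOn c (Icc 0 T)) :
    (fun z : ℝ × EuclideanSpace ℝ (Fin n) => c z.1 * (√(P.disc z.1 z.2) / 2 : ℝ))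
      =O[𝓟 (Icc 0 T ×ˢ univ)] fun z => √(P.disc z.1 z.2) := by
  have hbdd : c =O[𝓟 (Icc 0 T)] fun _ => (1 : ℝ) :=
    hc.isBigO_principal isCompact_Icc (by norm_num)
  have hfst : Tendsto Prod.fst (𝓟 (Icc 0 T ×ˢ (univ : Set (EuclideanSpace ℝ (Fin n)))))
      (𝓟 (Icc 0 T)) := tendsto_principal_principal.2 fun z hz => hz.1
  refine ((hbdd.comp_tendsto hfst).mul (isBigO_of_le (g := fun z => √(P.disc z.1 z.2)) _
    fun z => ?_)).trans (isBigO_of_le _ fun z => ?_)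
  · rw [Complex.norm_real, norm_div]
    exact div_le_self (norm_nonneg _) (by norm_num)
  · rw [Function.comp_apply, one_mul]

/-- The set of all `(t, ξ)` with `t ∈ [0, T]` and `Δ(t, ξ) ≠ 0`, where `Δ` is encoded as `disc`. -/
abbrev nondegenerateSet (P : ThirdOrderOperator n) (T : ℝ) : Set (ℝ × EuclideanSpace ℝ (Fin n)) :=
  {z | z.1 ∈ Icc 0 T ∧ P.disc z.1 z.2 ≠ 0}

theorem HasRealCriticalPoints.sqrt_disc_le (hc : P.HasRealCriticalPoints T) (ht : t ∈ Icc 0 T)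
    (ξ : EuclideanSpace ℝ (Fin n)) :
    √(P.disc t ξ) ≤ leviMajorant (fun s => P.disc s ξ) t :=
  sqrt_le_leviMajorant (p := fun s => P.disc s ξ) (hc.disc_nonneg ht ξ)

theorem HasRealCriticalPoints.leviMajorant_nonneg (hc : P.HasRealCriticalPoints T)
    (ht : t ∈ Icc 0 T) (ξ : EuclideanSpace ℝ (Fin n)) :
    0 ≤ leviMajorant (fun s => P.disc s ξ) t :=
  (Real.sqrt_nonneg _).trans (hc.sqrt_disc_le ht ξ)

theorem pointwiseLevi_iff_symNcheck (hT : 0 < T) (h : P.AnalyticCoefficients T)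
    (hc : P.HasRealCriticalPoints T) :
    P.PointwiseLevi T ↔ (fun z : ℝ × EuclideanSpace ℝ (Fin n) =>
        (P.symNcheck z.1 (P.σ₁ z.1 z.2) z.2, P.symNcheck z.1 (P.σ₂ z.1 z.2) z.2))
      =O[𝓟 (P.nondegenerateSet T)]
        fun z => leviMajorant (fun s => P.disc s z.2) z.1 := by
  rw [isBigO_principal_iff_exists_pos fun z hz => hc.leviMajorant_nonneg hz.1 z.2]
  refine exists_congr fun C => and_congr_right fun _ => ⟨fun hC z hz => ?_, fun hC t ht ξ hξ => ?_⟩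
  · rw [norm_prod_le_iff, leviMajorant_disc hT h hc hz.1]
    exact hC z.1 hz.1 z.2 ((Δ_eq_disc (hc.disc_nonneg hz.1 z.2)).trans_ne hz.2)
  · rw [← leviMajorant_disc hT h hc ht]
    exact norm_prod_le_iff.1
      (hC (t, ξ) ⟨ht, (Δ_eq_disc (hc.disc_nonneg ht ξ)).symm.trans_ne hξ⟩)

theorem pointwiseLevi_iff (hT : 0 < T) (h : P.AnalyticCoefficients T)
    (hc : P.HasRealCriticalPoints T) :
    P.PointwiseLevi T ↔ (fun z : ℝ × EuclideanSpace ℝ (Fin n) => P.mid z.1 z.2)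
      =O[𝓟 (P.nondegenerateSet T)]
        fun z => leviMajorant (fun s => P.disc s z.2) z.1 := by
  have hsqrt : (fun z : ℝ × EuclideanSpace ℝ (Fin n) => √(P.disc z.1 z.2))
      =O[𝓟 (P.nondegenerateSet T)]
        fun z => leviMajorant (fun s => P.disc s z.2) z.1 :=
    IsBigO.of_bound' (eventually_principal.2 fun z hz => by
      rw [Real.norm_of_nonneg (Real.sqrt_nonneg _)]
      exact (hc.sqrt_disc_le hz.1 z.2).trans (Real.le_norm_self _))
  have hslope : (fun z : ℝ × EuclideanSpace ℝ (Fin n) => P.slope z.1 * (√(P.disc z.1 z.2) / 2 : ℝ))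
      =O[𝓟 (P.nondegenerateSet T)]
        fun z => leviMajorant (fun s => P.disc s z.2) z.1 :=
    ((isBigO_mul_sqrt_disc h.slope.continuousOn).mono
      (principal_mono.2 fun z hz => ⟨hz.1, mem_univ _⟩)).trans hsqrt
  have hσ₁ : (fun z : ℝ × EuclideanSpace ℝ (Fin n) => P.symNcheck z.1 (P.σ₁ z.1 z.2) z.2)
      =ᶠ[𝓟 (P.nondegenerateSet T)]
        fun z => P.mid z.1 z.2 - P.slope z.1 * (√(P.disc z.1 z.2) / 2 : ℝ) :=
    eventuallyEq_principal.2 fun z hz => h.symNcheck_σ₁ hz.1 (hc.disc_nonneg hz.1 z.2)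
  have hσ₂ : (fun z : ℝ × EuclideanSpace ℝ (Fin n) => P.symNcheck z.1 (P.σ₂ z.1 z.2) z.2)
      =ᶠ[𝓟 (P.nondegenerateSet T)]
        fun z => P.mid z.1 z.2 + P.slope z.1 * (√(P.disc z.1 z.2) / 2 : ℝ) :=
    eventuallyEq_principal.2 fun z hz => h.symNcheck_σ₂ hz.1 (hc.disc_nonneg hz.1 z.2)
  rw [pointwiseLevi_iff_symNcheck hT h hc, isBigO_prod_left, isBigO_congr hσ₁ .rfl,
    isBigO_congr hσ₂ .rfl, hslope.sub_iff_left, hslope.add_iff_left, and_self_iff]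

theorem productLevi_iff (h : P.AnalyticCoefficients T) (hc : P.HasRealCriticalPoints T) :
    P.ProductLevi T ↔ ∃ S : Finset ℝ,
      (fun z : ℝ × EuclideanSpace ℝ (Fin n) => (∏ s ∈ S, (z.1 - s) ^ 2) • P.mid z.1 z.2)
        =O[𝓟 (Icc 0 T ×ˢ univ)] fun z => √(P.disc z.1 z.2) := by
  refine exists_congr fun S => ?_
  have hslope := isBigO_mul_sqrt_disc (P := P) (c := fun t => (∏ s ∈ S, (t - s) ^ 2) • P.slope t)
    ((by fun_prop : Continuous fun t => ∏ s ∈ S, (t - s) ^ 2).continuousOn.smul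
      h.slope.continuousOn)
  rw [← hslope.sub_iff_left, isBigO_principal_iff_exists_pos fun z _ => Real.sqrt_nonneg _]
  refine exists_congr fun C => and_congr_right fun _ => ?_
  rw [forall_prod_set]
  refine forall₂_congr fun t ht => ?_
  simp only [mem_univ, true_imp_iff]
  refine forall_congr' fun ξ => ?_
  have h0 := hc.disc_nonneg ht ξ
  rw [abs_σ₂_sub_σ₁ h0, h.symNcheck_σ₁ ht h0, smul_mul_assoc, ← smul_sub, norm_smul,
    Real.norm_of_nonneg (Finset.prod_nonneg fun s _ => sq_nonneg (t - s))]

end Reduction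

section IntegralReduction

open Set Filter Asymptotics

variable {n : ℕ} {P : ThirdOrderOperator n} {T t : ℝ} {ξ : EuclideanSpace ℝ (Fin n)}

theorem AnalyticCoefficients.continuousOn_leviDensity (h : P.AnalyticCoefficients T)
    (hc : P.HasRealCriticalPoints T) {g : ℝ → ℂ} (hg : ContinuousOn g (Icc 0 T))
    (ξ : EuclideanSpace ℝ (Fin n)) :
    ContinuousOn (leviDensity (fun s => P.disc s ξ) g) (Icc 0 T) :=
  _root_.continuousOn_leviDensity (h.disc ξ).continuousOn (fun _ hs => hc.disc_nonneg hs ξ) hg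

/-- Half the difference of the values of `Ň(t, ·, ξ)` at `μ₂` and at `μ₁`. -/
noncomputable def halfGap (P : ThirdOrderOperator n) (ξ : EuclideanSpace ℝ (Fin n)) (t : ℝ) : ℂ :=
  P.slope t * (√(P.disc t ξ + 8) / 2 : ℝ)

theorem AnalyticCoefficients.continuousOn_halfGap (h : P.AnalyticCoefficients T)
    (ξ : EuclideanSpace ℝ (Fin n)) : ContinuousOn (P.halfGap ξ) (Icc 0 T) :=
  h.slope.continuousOn.mul (Complex.continuous_ofReal.comp_continuousOn
    (((h.disc ξ).continuousOn.add continuousOn_const).sqrt.div_const 2))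

theorem leviDensity_halfGap (h0 : 0 ≤ P.disc t ξ) :
    leviDensity (fun s => P.disc s ξ) (P.halfGap ξ) t = √(‖P.slope t‖ / 2) := by
  have hsqrt : √(P.disc t ξ + 8) ≠ 0 := by positivity
  rw [leviDensity, halfGap, norm_mul, Complex.norm_real, Real.norm_of_nonneg (by positivity),
    mul_div_assoc, div_right_comm, div_self hsqrt, mul_one_div]

/-- The integrand of the Levi condition (B). -/
noncomputable def leviIntegrand (P : ThirdOrderOperator n) (ξ : EuclideanSpace ℝ (Fin n)) (t : ℝ) :
    ℝ :=
  leviDensity (fun s => P.disc s ξ) (fun s => P.mid s ξ - P.halfGap ξ s) t +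
    leviDensity (fun s => P.disc s ξ) (fun s => P.mid s ξ + P.halfGap ξ s) t

theorem AnalyticCoefficients.leviIntegrand_eq (h : P.AnalyticCoefficients T)
    (hc : P.HasRealCriticalPoints T) (ht : t ∈ Icc 0 T) (ξ : EuclideanSpace ℝ (Fin n)) :
    √(‖P.symNcheck t (P.μ₁ t ξ) ξ‖ / |P.μ₂ t ξ - P.μ₁ t ξ|) +
      √(‖P.symNcheck t (P.μ₂ t ξ) ξ‖ / |P.μ₂ t ξ - P.μ₁ t ξ|) = P.leviIntegrand ξ t := by
  have h0 : 0 ≤ P.disc t ξ + 8 := add_nonneg (hc.disc_nonneg ht ξ) (by norm_num)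
  rw [h.symNcheck_μ₁ ht h0, h.symNcheck_μ₂ ht h0, abs_μ₂_sub_μ₁ h0]
  rfl

theorem AnalyticCoefficients.intervalIntegrable_leviIntegrand (hT : 0 < T)
    (h : P.AnalyticCoefficients T) (hc : P.HasRealCriticalPoints T)
    (ξ : EuclideanSpace ℝ (Fin n)) :
    IntervalIntegrable (P.leviIntegrand ξ) MeasureTheory.volume 0 T :=
  have hmid := (h.mid ξ).continuousOn
  have hgap := h.continuousOn_halfGap ξ
  ((h.continuousOn_leviDensity hc (hmid.sub hgap) ξ).add
    (h.continuousOn_leviDensity hc (hmid.add hgap) ξ)).intervalIntegrable_of_Icc hT.le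

theorem isBigO_const_log_one_add_norm {E : Type*} [SeminormedAddCommGroup E] (c : ℝ) :
    (fun _ : E => c) =O[𝓟 {ξ | 1 ≤ ‖ξ‖}] fun ξ => Real.log (1 + ‖ξ‖) := by
  have hlog2 : 0 < Real.log 2 := Real.log_pos (by norm_num)
  refine IsBigO.of_bound (|c| / Real.log 2) (eventually_principal.2 fun ξ hξ => ?_)
  have hle : Real.log 2 ≤ Real.log (1 + ‖ξ‖) :=
    Real.log_le_log (by norm_num) (by linarith [mem_ofPred.1 hξ])
  rw [Real.norm_eq_abs, Real.norm_of_nonneg (hlog2.le.trans hle), div_mul_eq_mul_div,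
    le_div_iff₀ hlog2]
  gcongr

theorem integralLevi_iff_leviIntegrand (hT : 0 < T) (h : P.AnalyticCoefficients T)
    (hc : P.HasRealCriticalPoints T) :
    P.IntegralLevi T ↔
      (fun ξ : EuclideanSpace ℝ (Fin n) => ∫ t in (0 : ℝ)..T, P.leviIntegrand ξ t)
        =O[𝓟 {ξ | 1 ≤ ‖ξ‖}] fun ξ => Real.log (1 + ‖ξ‖) := by
  rw [isBigO_principal_iff_exists_pos fun ξ _ => Real.log_nonneg (by simp)]
  refine exists_congr fun C => and_congr_right fun _ => forall₂_congr fun ξ _ => ?_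
  have heq := fun t (ht : t ∈ uIcc 0 T) => h.leviIntegrand_eq hc (uIcc_of_le hT.le ▸ ht) ξ
  have hnonneg : 0 ≤ ∫ t in (0 : ℝ)..T, P.leviIntegrand ξ t :=
    intervalIntegral.integral_nonneg hT.le fun t _ =>
      add_nonneg (leviDensity_nonneg _ _ t) (leviDensity_nonneg _ _ t)
  rw [intervalIntegral.integral_congr heq, Real.norm_of_nonneg hnonneg]
  exact and_iff_right ((h.intervalIntegrable_leviIntegrand hT hc ξ).congr
    fun t ht => (heq t (uIoc_subset_uIcc ht)).symm)

theorem AnalyticCoefficients.integral_leviDensity_mid_le (hT : 0 < T)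
    (h : P.AnalyticCoefficients T) (hc : P.HasRealCriticalPoints T)
    (ξ : EuclideanSpace ℝ (Fin n)) :
    ∫ t in (0 : ℝ)..T, leviDensity (fun s => P.disc s ξ) (fun s => P.mid s ξ) t ≤
      ∫ t in (0 : ℝ)..T, P.leviIntegrand ξ t := by
  refine intervalIntegral.integral_mono_on hT.le
    ((h.continuousOn_leviDensity hc (h.mid ξ).continuousOn ξ).intervalIntegrable_of_Icc hT.le)
    (h.intervalIntegrable_leviIntegrand hT hc ξ) fun t _ => leviDensity_le_add ?_
  calc ‖P.mid t ξ‖ ≤ ‖(2 : ℝ) • P.mid t ξ‖ := by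
        rw [norm_smul, Real.norm_ofNat]
        linarith [norm_nonneg (P.mid t ξ)]
    _ = ‖(P.mid t ξ - P.halfGap ξ t) + (P.mid t ξ + P.halfGap ξ t)‖ := by
        rw [two_smul, sub_add_add_cancel]
    _ ≤ _ := norm_add_le _ _

theorem AnalyticCoefficients.integral_leviIntegrand_le (hT : 0 < T)
    (h : P.AnalyticCoefficients T) (hc : P.HasRealCriticalPoints T)
    (ξ : EuclideanSpace ℝ (Fin n)) :
    ∫ t in (0 : ℝ)..T, P.leviIntegrand ξ t ≤
      2 * (∫ t in (0 : ℝ)..T, leviDensity (fun s => P.disc s ξ) (fun s => P.mid s ξ) t) +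
        2 * ∫ t in (0 : ℝ)..T, √(‖P.slope t‖ / 2) := by
  have hmid := (h.continuousOn_leviDensity hc (h.mid ξ).continuousOn ξ).intervalIntegrable_of_Icc
    (μ := MeasureTheory.volume) hT.le
  have hslope := (h.slope.continuousOn.norm.div_const 2).sqrt.intervalIntegrable_of_Icc
    (μ := MeasureTheory.volume) hT.le
  rw [← mul_add, ← intervalIntegral.integral_add hmid hslope,
    ← intervalIntegral.integral_const_mul]
  refine intervalIntegral.integral_mono_on hT.le (h.intervalIntegrable_leviIntegrand hT hc ξ)
    ((hmid.add hslope).const_mul 2) fun t ht => ?_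
  rw [leviIntegrand, two_mul, ← leviDensity_halfGap (hc.disc_nonneg ht ξ)]
  exact add_le_add (leviDensity_le_add (norm_sub_le _ _)) (leviDensity_le_add (norm_add_le _ _))

theorem integralLevi_iff (hT : 0 < T) (h : P.AnalyticCoefficients T)
    (hc : P.HasRealCriticalPoints T) :
    P.IntegralLevi T ↔ (fun ξ : EuclideanSpace ℝ (Fin n) =>
        ∫ t in (0 : ℝ)..T, leviDensity (fun s => P.disc s ξ) (fun s => P.mid s ξ) t)
      =O[𝓟 {ξ | 1 ≤ ‖ξ‖}] fun ξ => Real.log (1 + ‖ξ‖) := by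
  have hmid_nonneg (ξ : EuclideanSpace ℝ (Fin n)) :
      0 ≤ ∫ t in (0 : ℝ)..T, leviDensity (fun s => P.disc s ξ) (fun s => P.mid s ξ) t :=
    intervalIntegral.integral_nonneg hT.le fun t _ => leviDensity_nonneg _ _ t
  have hmid_le := h.integral_leviDensity_mid_le hT hc
  have hle := h.integral_leviIntegrand_le hT hc
  rw [integralLevi_iff_leviIntegrand hT h hc]
  constructor <;> intro hO
  · exact (isBigO_of_le _ fun ξ => abs_le_abs_of_nonneg (hmid_nonneg ξ) (hmid_le ξ)).trans hO
  · exact (isBigO_of_le _ fun ξ => abs_le_abs_of_nonneg ((hmid_nonneg ξ).trans (hmid_le ξ))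
      (hle ξ)).trans ((hO.const_mul_left 2).add (isBigO_const_log_one_add_norm _))

end IntegralReduction

section Conditions

open Set Filter Asymptotics Topology

variable {n : ℕ} {P : ThirdOrderOperator n} {T : ℝ}

theorem PointwiseLevi.integralLevi (hA : P.PointwiseLevi T) (hT : 0 < T)
    (h : P.AnalyticCoefficients T) (hc : P.HasRealCriticalPoints T)
    (hne : ∃ t ∈ Icc 0 T, ∃ ξ, P.disc t ξ ≠ 0) : P.IntegralLevi T := by
  choose Q hQ using P.exists_quadraticForm_disc
  choose ℓ hℓ using P.exists_linearMap_mid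
  obtain ⟨C, hC, hlevi⟩ := (isBigO_principal_iff_exists_pos fun z hz =>
    hc.leviMajorant_nonneg hz.1 z.2).1 ((pointwiseLevi_iff hT h hc).1 hA)
  obtain ⟨D, hD⟩ := exists_integral_leviDensity_le hT (Q := Q) (ℓ := ℓ)
    (fun ξ => by simpa only [hQ] using h.disc ξ)
    (fun t ht ξ => by simpa only [hQ] using hc.disc_nonneg ht ξ)
    (fun ξ => by simpa only [hℓ] using h.mid ξ) (by simpa only [hQ] using hne) hC.le
    (fun t ht ξ hξ => by simpa only [hQ, hℓ] using hlevi (t, ξ) ⟨ht, (hQ t ξ).trans_ne hξ⟩)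
  refine (integralLevi_iff hT h hc).2 (IsBigO.of_bound D (eventually_principal.2 fun ξ hξ => ?_))
  rw [Real.norm_of_nonneg (intervalIntegral.integral_nonneg hT.le fun t _ =>
    leviDensity_nonneg _ _ t), Real.norm_of_nonneg (Real.log_nonneg (by simp))]
  simpa only [hQ, hℓ] using hD ξ hξ

/-- At every point of `[0, T]`, the vanishing orders `k` of `Δ(·, ξ)` and `m` of `Ň(·, -A/3, ξ)`
are related by `k ≤ 2m + 4`. This is stated as `(t - x)² Ň = O(√Δ)` for `t → x` in `[0, T]`, which
also covers infinite orders. -/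
def LocalLevi (P : ThirdOrderOperator n) (T : ℝ) (ξ : EuclideanSpace ℝ (Fin n)) : Prop :=
  ∀ x ∈ Icc 0 T, (fun t => (t - x) ^ 2 • P.mid t ξ) =O[𝓝[Icc 0 T] x] fun t => √(P.disc t ξ)

variable {ξ : EuclideanSpace ℝ (Fin n)}

theorem IntegralLevi.localLevi (hB : P.IntegralLevi T) (hT : 0 < T)
    (h : P.AnalyticCoefficients T) (hc : P.HasRealCriticalPoints T)
    (hne : ∃ t ∈ Icc 0 T, P.disc t ξ ≠ 0) (hξ : ‖ξ‖ = 1) : P.LocalLevi T ξ := by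
  obtain ⟨C, hC⟩ := ((integralLevi_iff hT h hc).1 hB).bound
  rw [eventually_principal] at hC
  refine fun x hx => sq_smul_isBigO_sqrt_of_integral_leviDensity_le hT (h.disc ξ)
    (fun t ht => hc.disc_nonneg ht ξ) hne (h.mid ξ) (C := C) (fun R hR => ?_) hx
  have hnorm : ‖R • ξ‖ = R := by
    rw [norm_smul, hξ, mul_one, Real.norm_of_nonneg (zero_le_one.trans hR)]
  have hle := (Real.le_norm_self _).trans (hC (R • ξ) (hR.trans_eq hnorm.symm))
  simpa only [hnorm, disc_smul, mid_smul,
    Real.norm_of_nonneg (Real.log_nonneg (by linarith : 1 ≤ 1 + R))] using hle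

theorem ProductLevi.localLevi (hC : P.ProductLevi T) (h : P.AnalyticCoefficients T)
    (hc : P.HasRealCriticalPoints T) : P.LocalLevi T ξ := by
  obtain ⟨S, hS⟩ := (productLevi_iff h hc).1 hC
  have hslice : Tendsto (fun t => (t, ξ)) (𝓟 (Icc 0 T)) (𝓟 (Icc 0 T ×ˢ univ)) :=
    tendsto_principal_principal.2 fun t ht => ⟨ht, mem_univ _⟩
  exact fun x _ => sq_smul_isBigO_of_prod_smul (hS.comp_tendsto hslice)

end Conditions

section OneDimensional

open Set Filter Asymptotics

variable {P : ThirdOrderOperator 1} {T : ℝ}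

/-- The unit vector of the line. -/
noncomputable abbrev unitVec : EuclideanSpace ℝ (Fin 1) := EuclideanSpace.single 0 1

theorem eq_smul_unitVec (ξ : EuclideanSpace ℝ (Fin 1)) : ξ = ξ 0 • unitVec := by
  ext i
  simp [Subsingleton.elim i 0]

theorem sqrt_disc_eq (t : ℝ) (ξ : EuclideanSpace ℝ (Fin 1)) :
    √(P.disc t ξ) = |ξ 0| * √(P.disc t unitVec) := by
  conv_lhs => rw [eq_smul_unitVec ξ, disc_smul, Real.sqrt_mul (sq_nonneg _), Real.sqrt_sq_eq_abs]

theorem LocalLevi.productLevi (hloc : P.LocalLevi T unitVec) (h : P.AnalyticCoefficients T)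
    (hc : P.HasRealCriticalPoints T) (hne : ∃ t ∈ Icc 0 T, P.disc t unitVec ≠ 0) :
    P.ProductLevi T := by
  obtain ⟨S, hS⟩ := exists_prod_smul_isBigO_sqrt (h.disc unitVec) (h.mid unitVec).continuousOn
    (fun t ht => hc.disc_nonneg ht unitVec) hne hloc
  have hfst : Tendsto Prod.fst (𝓟 (Icc 0 T ×ˢ (univ : Set (EuclideanSpace ℝ (Fin 1)))))
      (𝓟 (Icc 0 T)) := tendsto_principal_principal.2 fun z hz => hz.1
  refine (productLevi_iff h hc).2 ⟨S, (((isBigO_refl (fun z => z.2 0) _).abs_right.smul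
    (hS.comp_tendsto hfst)).congr (fun z => ?_) fun z => (sqrt_disc_eq z.1 z.2).symm)⟩
  conv_rhs => rw [eq_smul_unitVec z.2, mid_smul]
  exact smul_comm _ _ _

theorem LocalLevi.pointwiseLevi (hloc : P.LocalLevi T unitVec) (hT : 0 < T)
    (h : P.AnalyticCoefficients T) (hc : P.HasRealCriticalPoints T) : P.PointwiseLevi T := by
  have hO := isBigO_leviMajorant (h.disc unitVec) (h.mid unitVec).continuousOn
    (fun t ht => hc.disc_nonneg ht unitVec) hloc
  have hfst : Tendsto Prod.fst (𝓟 (P.nondegenerateSet T))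
      (𝓟 {t ∈ Icc 0 T | P.disc t unitVec ≠ 0}) :=
    tendsto_principal_principal.2 fun z hz => ⟨hz.1, fun h0 => hz.2 <| by
      rw [eq_smul_unitVec z.2, disc_smul, h0, mul_zero]⟩
  refine (pointwiseLevi_iff hT h hc).2 (((isBigO_refl (fun z => z.2 0) _).abs_right.smul
    (hO.comp_tendsto hfst)).congr (fun z => ?_) fun z => ?_)
  · conv_rhs => rw [eq_smul_unitVec z.2, mid_smul]
    rfl
  · conv_rhs => rw [eq_smul_unitVec z.2]
    simp only [disc_smul, leviMajorant_sq_mul]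
    rfl

theorem exists_disc_unitVec_ne_zero (hne : ∃ t ∈ Icc 0 T, ∃ ξ, P.disc t ξ ≠ 0) :
    ∃ t ∈ Icc 0 T, P.disc t unitVec ≠ 0 := by
  obtain ⟨t, ht, ξ, hξ⟩ := hne
  rw [eq_smul_unitVec ξ, disc_smul] at hξ
  exact ⟨t, ht, right_ne_zero_of_mul hξ⟩

end OneDimensional

end ThirdOrderOperator

theorem mainTheorem10_general {n : ℕ} (P : ThirdOrderOperator n) {T : ℝ} (hT : 0 < T)
    (hanalytic : P.AnalyticCoefficients T) (hcrit : P.HasRealCriticalPoints T)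
    (hΔ : ∃ t ∈ Set.Icc 0 T, ∃ ξ : EuclideanSpace ℝ (Fin n), P.Δ t ξ ≠ 0) :
    (P.PointwiseLevi T → P.IntegralLevi T) ∧
    (n = 1 →
      (P.PointwiseLevi T ↔ P.IntegralLevi T) ∧ (P.PointwiseLevi T ↔ P.ProductLevi T)) := by
  have hne : ∃ t ∈ Set.Icc 0 T, ∃ ξ, P.disc t ξ ≠ 0 :=
    let ⟨t, ht, ξ, hξ⟩ := hΔ
    ⟨t, ht, ξ, ThirdOrderOperator.Δ_eq_disc (hcrit.disc_nonneg ht ξ) ▸ hξ⟩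
  have hAB (hA : P.PointwiseLevi T) : P.IntegralLevi T := hA.integralLevi hT hanalytic hcrit hne
  refine ⟨hAB, ?_⟩
  rintro rfl
  have hne₁ := ThirdOrderOperator.exists_disc_unitVec_ne_zero hne
  have hB (hB : P.IntegralLevi T) : P.LocalLevi T ThirdOrderOperator.unitVec :=
    hB.localLevi hT hanalytic hcrit hne₁ (by simp)
  exact ⟨⟨hAB, fun h => (hB h).pointwiseLevi hT hanalytic hcrit⟩,
    fun h => (hB (hAB h)).productLevi hanalytic hcrit hne₁,
    fun h => (h.localLevi hanalytic hcrit).pointwiseLevi hT hanalytic hcrit⟩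

theorem mainTheorem10 {n : ℕ} (P : ThirdOrderOperator n) {T : ℝ} (hT : 0 < T)
    (hanalytic : P.AnalyticCoefficients T) (hhyp : P.WeaklyHyperbolic T)
    (hΔ : ∃ t ∈ Set.Icc 0 T, ∃ ξ : EuclideanSpace ℝ (Fin n), P.Δ t ξ ≠ 0) :
    (P.PointwiseLevi T → P.IntegralLevi T) ∧
    (n = 1 →
      (P.PointwiseLevi T ↔ P.IntegralLevi T) ∧ (P.PointwiseLevi T ↔ P.ProductLevi T)) :=
  mainTheorem10_general P hT hanalytic hhyp.hasRealCriticalPoints hΔ
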